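/- Let $X$ be a smooth complex surface, $C\subset X$ a curve and $P\in C$ a point at which $C$ is unibranch (its analytic germ at $P$ is irreducible). Recall that the Puiseux characteristic $(m;\beta_1,\dots,\beta_g)$ of $C$ at $P$ is obtained from local parameters $(x,y)$ at $P$ with $x=0$ not tangent to $C$ and a good (generically injective) parametrization $x=t^m$, $y=\sum_{k\ge m}c_kt^k$ of the germ of $C$: put $m_1=m$; for $j\ge 1$, as long as $m_j\neq 1$, let $\beta_j$ be the least exponent $k$ with $c_k\ne 0$ and $m_j\nmid k$, and let $m_{j+1}=\gcd(m_j,\beta_j)$; the construction stops when $m_{g+1}=1$. The integers $\beta_1,\dots,\beta_g$ are the characteristic exponents. Suppose that $C$ has Puiseux characteristic $(m;\beta_1,\dots,\beta_g)$ at $P$. Consider a finite sequence of successive blowings up desingularizing $C$ at $P$: $X_0=X$, $C_0=C$, $P_0=P$; $X_{n+1}$ is the blowing up of $X_n$ at $P_n$, $C_{n+1}$ is the strict transform of $C_n$, $P_{n+1}$ is the point of $C_{n+1}$ over $P_n$, for $0\le n<N$; and $C_N$ is smooth at $P_N$. Then for every $1\le j\le g$ there is a member of the sequence $C_0,C_1,\dots,C_N$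 whose Puiseux characteristic (at the corresponding point $P_n$) has exactly $g-j+1$ characteristic exponents, and the first such Puiseux characteristic is $$\bigl(m_j;\beta_j^{(j-1)},\dots,\beta_g^{(j-1)}\bigr),$$ where $\beta_k^{(0)}=\beta_k$ and, for $2\le j\le k\le g$, $$\beta_k^{(j-1)}=\beta_k-\beta_{j-1}+a_{j-1}m_j,$$ with $a_{j-1}$ the last quotient in the Euclidean algorithm for $m_{j-1}$ and $\beta_{j-1}$. -/

import Mathlib

open scoped Manifold ContDiff Topology

namespace SurfaceCurve

/-! Smooth complex surfaces are Hausdorff complex-analytic manifolds modelled on `ℂ × ℂ`.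
Systems of local parameters are charts of the maximal analytic atlas; curves are reduced, so
they are given by their sets of points. -/

section Curves

variable {X : Type*} [TopologicalSpace X] [ChartedSpace (ℂ × ℂ) X]

/-- Near `P`, the set `A` is the common zero set of finitely many holomorphic functions. -/
def IsAnalyticSetAt (A : Set X) (P : X) : Prop :=
  ∃ (r : ℕ) (F : Fin r → X → ℂ),
    (∀ i, ContMDiffAt 𝓘(ℂ, ℂ × ℂ) 𝓘(ℂ, ℂ) ω (F i) P) ∧
    ∀ᶠ Q in 𝓝 P, (Q ∈ A ↔ ∀ i, F i Q = 0)

/-- A (reduced) curve on the surface `X`: a closed subset which, near each of its points, is the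
zero set of one holomorphic function that does not vanish identically. -/
def IsCurve (C : Set X) : Prop :=
  IsClosed C ∧ ∀ Q ∈ C, ∃ F : X → ℂ,
    ContMDiffAt 𝓘(ℂ, ℂ × ℂ) 𝓘(ℂ, ℂ) ω F Q ∧
    (∀ᶠ R in 𝓝 Q, (R ∈ C ↔ F R = 0)) ∧ ¬ (∀ᶠ R in 𝓝 Q, F R = 0)

/-- The curve `C` is unibranch at `P`: it passes through `P` and its analytic germ at `P` is
irreducible, i.e. not the union of two analytic germs different from it. -/
def IsUnibranchAt (C : Set X) (P : X) : Prop :=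
  P ∈ C ∧ ∀ A B : Set X, IsAnalyticSetAt A P → IsAnalyticSetAt B P →
    (∀ᶠ Q in 𝓝 P, (Q ∈ C ↔ Q ∈ A ∨ Q ∈ B)) →
    (∀ᶠ Q in 𝓝 P, (Q ∈ C ↔ Q ∈ A)) ∨ (∀ᶠ Q in 𝓝 P, (Q ∈ C ↔ Q ∈ B))

/-- The curve `C` passes through `P` and is nonsingular there: in suitable local parameters
centred at `P` it is a coordinate line. -/
def IsSmoothAt (C : Set X) (P : X) : Prop :=
  ∃ e ∈ IsManifold.maximalAtlas 𝓘(ℂ, ℂ × ℂ) ω X, P ∈ e.source ∧ e P = 0 ∧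
    ∀ Q ∈ e.source, (Q ∈ C ↔ (e Q).2 = 0)

/-- The integers `m_j` attached to `m` and `β_1, β_2, …`:
`m_1 = m` and `m_{j+1} = gcd(m_j, β_j)` for `j ≥ 1`. (The value at `0` is never used.) -/
def gcdSeq (m : ℕ) (β : ℕ → ℕ) : ℕ → ℕ
  | 0 => m
  | 1 => m
  | j + 2 => Nat.gcd (gcdSeq m β (j + 1)) (β (j + 1))

/-- `x = t ^ m`, `y = ∑_{k ≥ m} c_k t ^ k` with `‖t‖ < ε` is a parametrization of the germ of `C`
at `P` in the local parameters `e = (x, y)` centred at `P`. The vanishing of `c_k` for `k < m`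
says that `x = 0` is not tangent to `C`. -/
structure IsParametrization (C : Set X) (P : X) (e : OpenPartialHomeomorph X (ℂ × ℂ))
    (m : ℕ) (c : ℕ → ℂ) (ε : ℝ) : Prop where
  chart : e ∈ IsManifold.maximalAtlas 𝓘(ℂ, ℂ × ℂ) ω X
  mem_source : P ∈ e.source
  centred : e P = 0
  m_pos : 0 < m
  coeff_eq_zero : ∀ k < m, c k = 0
  eps_pos : 0 < ε
  summable : ∀ t : ℂ, ‖t‖ < ε → Summable fun k => c k * t ^ k
  germ : ∀ᶠ Q in 𝓝 P, (Q ∈ C ↔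
    ∃ t : ℂ, ‖t‖ < ε ∧ (e Q).1 = t ^ m ∧ HasSum (fun k => c k * t ^ k) (e Q).2)

/-- The Puiseux characteristic of `C` at `P` is `(m; β_1, …, β_g)`; only the values `β j` with
`1 ≤ j ≤ g` matter. There is a parametrization `x = t ^ m`, `y = ∑_{k ≥ m} c_k t ^ k` for which
`β_j` is the least exponent occurring in `y` that is not a multiple of `m_j`, and the construction
stops at `m_{g+1} = 1` (so the parametrization is good, i.e. generically one-to-one). -/
def HasPuiseuxChar (C : Set X) (P : X) (m g : ℕ) (β : ℕ → ℕ) : Prop :=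
  ∃ (e : OpenPartialHomeomorph X (ℂ × ℂ)) (c : ℕ → ℂ) (ε : ℝ),
    IsParametrization C P e m c ε ∧
    (∀ j, 1 ≤ j → j ≤ g → IsLeast {k : ℕ | c k ≠ 0 ∧ ¬ gcdSeq m β j ∣ k} (β j)) ∧
    gcdSeq m β (g + 1) = 1

end Curves

section Blowup

variable {X Y : Type*} [TopologicalSpace X] [ChartedSpace (ℂ × ℂ) X]
  [TopologicalSpace Y] [ChartedSpace (ℂ × ℂ) Y]

/-- `π : Y → X` is the blowing up of the surface `X` at the point `P`: it is biholomorphic away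
from `P`, and over a coordinate neighbourhood of `P` it is given by the two standard affine
charts `(u, v) ↦ (u, u v)` and `(u, v) ↦ (u v, v)` with their usual glueing. -/
structure IsBlowupAt (π : Y → X) (P : X) : Prop where
  holomorphic : ContMDiff 𝓘(ℂ, ℂ × ℂ) 𝓘(ℂ, ℂ × ℂ) ω π
  bijOn : Set.BijOn π (π ⁻¹' {P}ᶜ) {P}ᶜ
  localDiffeo : ∀ Q, π Q ≠ P →
    IsLocalDiffeomorphAt 𝓘(ℂ, ℂ × ℂ) 𝓘(ℂ, ℂ × ℂ) ω π Q
  charts : ∃ e ∈ IsManifold.maximalAtlas 𝓘(ℂ, ℂ × ℂ) ω X,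
    ∃ f₁ ∈ IsManifold.maximalAtlas 𝓘(ℂ, ℂ × ℂ) ω Y,
    ∃ f₂ ∈ IsManifold.maximalAtlas 𝓘(ℂ, ℂ × ℂ) ω Y,
      P ∈ e.source ∧ e P = 0 ∧
      π ⁻¹' e.source = f₁.source ∪ f₂.source ∧
      f₁.target = {w | (w.1, w.1 * w.2) ∈ e.target} ∧
      f₂.target = {w | (w.1 * w.2, w.2) ∈ e.target} ∧
      (∀ Q ∈ f₁.source, e (π Q) = ((f₁ Q).1, (f₁ Q).1 * (f₁ Q).2)) ∧
      (∀ Q ∈ f₂.source, e (π Q) = ((f₂ Q).1 * (f₂ Q).2, (f₂ Q).2)) ∧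
      (∀ Q ∈ f₁.source, (Q ∈ f₂.source ↔ (f₁ Q).2 ≠ 0)) ∧
      (∀ Q ∈ f₁.source, Q ∈ f₂.source →
        f₂ Q = ((f₁ Q).2⁻¹, (f₁ Q).1 * (f₁ Q).2))

/-- The strict transform of `C` under the blowing up `π` at `P`. -/
def strictTransform (π : Y → X) (P : X) (C : Set X) : Set Y :=
  closure (π ⁻¹' (C \ {P}))

end Blowup

/-- The last quotient in the Euclidean algorithm
`r₀ = a₁ r₁ + r₂, …, r_{s-1} = a_s r_s` (value `0` if `r₁ = 0`). -/
def lastQuotient : ℕ → ℕ → ℕ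
  | _, 0 => 0
  | a, b + 1 =>
    if a % (b + 1) = 0 then a / (b + 1) else lastQuotient (b + 1) (a % (b + 1))
termination_by _ b => b
decreasing_by exact Nat.mod_lt _ (Nat.succ_pos b)

/-- `β_k^{(j-1)}`: equal to `β_k` for `j = 1`, and to `β_k - β_{j-1} + a_{j-1} m_j` for `j ≥ 2`,
where `a_{j-1}` is the last quotient in the Euclidean algorithm for `m_{j-1}` and `β_{j-1}`.
It is used for `k ≥ j`, where `β_k > β_{j-1}`. -/
def transformedExponent (m : ℕ) (β : ℕ → ℕ) (j k : ℕ) : ℕ :=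
  if j = 1 then β k
  else β k - β (j - 1) + lastQuotient (β (j - 1)) (gcdSeq m β (j - 1)) * gcdSeq m β j

end SurfaceCurve

namespace SurfaceCurve

open Filter Asymptotics

/-! ### Orders of vanishing, local inverses and roots of analytic germs in one variable. -/

section PowerSeries

/-! The coefficient condition behind a characteristic exponent is rewritten as a symmetry: all
exponents of `f` below `b` are divisible by `d` exactly when `f (ζ t) - f t = O(t ^ b)` for every
`d`-th root of unity `ζ`. So β_j measures how far `f` is invariant under the m_j-th roots of unity
(`isCharExp_iff_isLeast`). Such estimates survive analytic changes of coordinates, which are locally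
Lipschitz, and reparametrization by a root of a coordinate (`isBigO_symmetry_of_root`); no
coefficient has to be followed through a substitution.

For one blowing up, write y = x k, so that the exponents of k are those of y lowered by m. If β_1 >
2m, the result is already in Puiseux form, with characteristic (m; β_i - m). If β_1 = m + n with n <
m, then k - k(0) has order n and the coordinates are interchanged; symmetry modulo t^(n+b) becomes
symmetry modulo t^(m+b). This gives (n; m, β_2 - β_1 + m, ...) when n does not divide m, and (n; β_2
- β_1 + m, ...) when it does (`HasPuiseuxChar.blowup`).

These are the steps of Euclid's algorithm for β_1 and m. The differences β_i - β_1 never change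
until the first exponent disappears, and at that moment the constant added to them is the current
multiplicity, which is the last quotient times the gcd. A smooth point has no characteristic
exponents, so the drop must occur (`exists_length_drop`); induction on j then gives the formula.

That the member found is the first one requires the number of exponents to be independent of all
choices. By `IsPuiseuxGerm.unique`, two primitive parametrizations of a germ have the same
multiplicity and the same symmetries. -/

theorem le_of_pow_isBigO_pow {k n : ℕ}
    (h : (fun t : ℂ => t ^ k) =O[𝓝 0] fun t => t ^ n) : n ≤ k := by
  by_contra! hlt
  have h1 : (fun t : ℂ => t ^ n) =o[𝓝 0] fun t => t ^ k := isLittleO_pow_pow hlt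
  have h2 := (h.trans_isLittleO h1)
  refine isLittleO_irrefl' ?_ h2
  have h3 : ∃ᶠ t in 𝓝[≠] (0 : ℂ), ‖t ^ k‖ ≠ 0 := by
    refine Eventually.frequently ?_
    filter_upwards [self_mem_nhdsWithin] with t ht
    exact norm_ne_zero_iff.2 (pow_ne_zero _ ht)
  exact h3.filter_mono nhdsWithin_le_nhds

theorem pow_isBigO_pow {k n : ℕ} (h : n ≤ k) :
    (fun t : ℂ => t ^ k) =O[𝓝 0] fun t => t ^ n := by
  rcases h.eq_or_lt with rfl | h
  · exact isBigO_refl _ _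
  · exact (isLittleO_pow_pow h).isBigO

theorem hasFPowerSeriesAt_ofScalars {f : ℂ → ℂ} {c : ℕ → ℂ}
    (h : ∀ᶠ t in 𝓝 (0 : ℂ), HasSum (fun k => c k * t ^ k) (f t)) :
    HasFPowerSeriesAt f (FormalMultilinearSeries.ofScalars ℂ c) 0 := by
  rw [hasFPowerSeriesAt_iff]
  filter_upwards [h] with t ht
  simpa [FormalMultilinearSeries.coeff_ofScalars, mul_comm] using ht

/-- Subtracting the leading term raises the order by one, so the coefficients are peeled off one at
a time. This is the only bridge between coefficients and growth. -/
theorem isBigO_pow_iff_coeff_eq_zero {f : ℂ → ℂ} {c : ℕ → ℂ}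
    (h : ∀ᶠ t in 𝓝 (0 : ℂ), HasSum (fun k => c k * t ^ k) (f t)) (b : ℕ) :
    f =O[𝓝 0] (fun t => t ^ b) ↔ ∀ k < b, c k = 0 := by
  have key : ∀ b, (∀ k < b, c k = 0) →
      (fun t => f t - c b * t ^ b) =O[𝓝 0] (fun t : ℂ => t ^ (b + 1)) := by
    intro b hb
    have := (hasFPowerSeriesAt_ofScalars h).isBigO_sub_partialSum_pow (b + 1)
    simp only [zero_add] at this
    refine (this.congr_left ?_).trans (IsBigO.of_bound 1 ?_)
    · intro t
      rw [FormalMultilinearSeries.partialSum, Finset.sum_range_succ, Finset.sum_eq_zero]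
      · simp [FormalMultilinearSeries.ofScalars]
      · intro k hk
        simp [FormalMultilinearSeries.ofScalars, hb k (Finset.mem_range.1 hk)]
    · filter_upwards with t
      simp
  induction b with
  | zero =>
    simp only [pow_zero, not_lt_zero, IsEmpty.forall_iff, implies_true, iff_true]
    have := (hasFPowerSeriesAt_ofScalars h).analyticAt.continuousAt
    simpa using this.norm.isBoundedUnder_le
  | succ b ih =>
    constructor
    · intro hf
      have hb := ih.1 (hf.trans (pow_isBigO_pow b.le_succ))
      intro k hk
      rcases Nat.lt_succ_iff_lt_or_eq.1 hk with hk | rfl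
      · exact hb k hk
      · by_contra hc
        have h1 : (fun t : ℂ => c k * t ^ k) =O[𝓝 0] (fun t : ℂ => t ^ (k + 1)) :=
          (hf.sub (key k hb)).congr_left fun t => by ring
        have h2 := (isBigO_const_mul_left_iff hc).1 h1
        have := le_of_pow_isBigO_pow h2
        omega
    · intro hc
      have := key b fun k hk => hc k (hk.trans b.lt_succ_self)
      simpa [hc b b.lt_succ_self] using this

theorem pow_isBigO_of_eventually_eq {f g : ℂ → ℂ} {k : ℕ} (hg : AnalyticAt ℂ g 0)
    (hg0 : g 0 ≠ 0) (hfg : ∀ᶠ t in 𝓝 0, f t = t ^ k * g t) :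
    (fun t : ℂ => t ^ k) =O[𝓝 0] f := by
  have h2 : (fun _ : ℂ => (1 : ℂ)) =O[𝓝 0] g :=
    (isBigO_const_left_iff_pos_le_norm one_ne_zero).2
      ⟨‖g 0‖ / 2, by positivity, (hg.continuousAt.norm.eventually
        (lt_mem_nhds (half_lt_self (norm_pos_iff.2 hg0)))).mono fun _ h => h.le⟩
  refine ((isBigO_refl (fun t : ℂ => t ^ k) (𝓝 0)).mul h2).congr' (by simp) ?_
  filter_upwards [hfg] with t ht using ht.symm

theorem AnalyticAt.isBigO_pow_iff_exists {f : ℂ → ℂ} (hf : AnalyticAt ℂ f 0) (n : ℕ) :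
    f =O[𝓝 0] (fun t => t ^ n) ↔
      ∃ g, AnalyticAt ℂ g 0 ∧ ∀ᶠ t in 𝓝 (0 : ℂ), f t = t ^ n * g t := by
  constructor
  · intro h
    have hle : (n : ℕ∞) ≤ analyticOrderAt f 0 := by
      by_contra! hlt
      obtain ⟨k, hk⟩ := ENat.ne_top_iff_exists.1 hlt.ne_top
      obtain ⟨g, hg, hg0, hfg⟩ := hf.analyticOrderAt_eq_natCast.1 hk.symm
      simp only [sub_zero, smul_eq_mul] at hfg
      rw [← hk] at hlt
      have h1 := pow_isBigO_of_eventually_eq hg hg0 hfg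
      have := le_of_pow_isBigO_pow (h1.trans h)
      exact absurd (by exact_mod_cast hlt) (not_lt.2 this)
    simpa using (natCast_le_analyticOrderAt hf).1 hle
  · rintro ⟨g, hg, hfg⟩
    have h1 : g =O[𝓝 0] fun _ => (1 : ℂ) := by
      simpa using hg.continuousAt.norm.isBoundedUnder_le
    refine ((isBigO_refl (fun t : ℂ => t ^ n) (𝓝 0)).mul h1).congr' ?_ (by simp)
    filter_upwards [hfg] with t ht using ht.symm

theorem AnalyticAt.pow_isBigO_of_not_isBigO {f : ℂ → ℂ} (hf : AnalyticAt ℂ f 0) {n : ℕ}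
    (h : ¬ f =O[𝓝 0] fun t => t ^ (n + 1)) : (fun t => t ^ n) =O[𝓝 0] f := by
  have hne : analyticOrderAt f 0 ≠ ⊤ := by
    intro htop
    refine h ((isBigO_zero _ _).congr' ?_ EventuallyEq.rfl)
    filter_upwards [analyticOrderAt_eq_top.1 htop] with t ht using ht.symm
  obtain ⟨k, hk⟩ := ENat.ne_top_iff_exists.1 hne
  obtain ⟨g, hg, hg0, hfg⟩ := hf.analyticOrderAt_eq_natCast.1 hk.symm
  simp only [sub_zero, smul_eq_mul] at hfg
  have hkn : k ≤ n := by
    by_contra! hlt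
    exact h (((AnalyticAt.isBigO_pow_iff_exists hf k).2 ⟨g, hg, hfg⟩).trans (pow_isBigO_pow hlt))
  exact (pow_isBigO_pow hkn).trans (pow_isBigO_of_eventually_eq hg hg0 hfg)

/-- Local inverses of analytic functions of one variable, together with the induced
equality of neighbourhood filters. -/
theorem exists_local_inverse {T : ℂ → ℂ} (hT : AnalyticAt ℂ T 0) (h0 : T 0 = 0)
    (hd : deriv T 0 ≠ 0) :
    ∃ S : ℂ → ℂ, AnalyticAt ℂ S 0 ∧ S 0 = 0 ∧ (∀ᶠ t in 𝓝 0, S (T t) = t) ∧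
      (∀ᶠ s in 𝓝 0, T (S s) = s) ∧ map T (𝓝 0) = 𝓝 0 ∧ map S (𝓝 0) = 𝓝 0 ∧
      (T =O[𝓝 0] fun t => t) ∧ (S =O[𝓝 0] fun t => t) := by
  have hs : HasStrictDerivAt T (deriv T 0) 0 := hT.hasStrictDerivAt
  have hs' := hs.hasStrictFDerivAt_equiv hd
  set S := hs.localInverse T (deriv T 0) 0 hd with hS
  have hSan : AnalyticAt ℂ S 0 := by
    have h1 : ContDiffAt ℂ ω T 0 := hT.contDiffAt
    have := h1.to_localInverse (f' := ContinuousLinearEquiv.unitsEquivAut ℂ (Units.mk0 _ hd))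
      hs'.hasFDerivAt (by simp)
    rw [h0] at this
    exact this.analyticAt
  have hST : ∀ᶠ t in 𝓝 0, S (T t) = t := hs'.eventually_left_inverse
  have hTS : ∀ᶠ s in 𝓝 0, T (S s) = s := by
    have := hs'.eventually_right_inverse
    rw [h0] at this
    exact this
  have hS0 : S 0 = 0 := by simpa [h0] using hST.self_of_nhds
  have hmT : map T (𝓝 0) = 𝓝 0 := by
    have := hs.map_nhds_eq hd
    rwa [h0] at this
  have hO : ∀ {F : ℂ → ℂ}, AnalyticAt ℂ F 0 → F 0 = 0 → F =O[𝓝 0] fun t => t := by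
    intro F hF hF0
    simpa [hF0] using hF.differentiableAt.isBigO_sub
  refine ⟨S, hSan, hS0, hST, hTS, hmT, ?_, hO hT h0, hO hSan hS0⟩
  conv_lhs => rw [← hmT]
  rw [Filter.map_map, Filter.map_congr (show S ∘ T =ᶠ[𝓝 0] id from hST), Filter.map_id]

/-- An analytic function with a zero of exact order `n ≥ 1` is the `n`-th power of a local
parameter. -/
theorem exists_root_of_exact_order {x : ℂ → ℂ} {n : ℕ} (hn : 0 < n) (hx : AnalyticAt ℂ x 0)
    (h1 : x =O[𝓝 0] fun t => t ^ n) (h2 : (fun t => t ^ n) =O[𝓝 0] x) :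
    ∃ T : ℂ → ℂ, AnalyticAt ℂ T 0 ∧ T 0 = 0 ∧ deriv T 0 ≠ 0 ∧
      ∀ᶠ t in 𝓝 0, T t ^ n = x t := by
  obtain ⟨u, hu, hxu⟩ := (AnalyticAt.isBigO_pow_iff_exists hx n).1 h1
  have hu0 : u 0 ≠ 0 := by
    intro h0
    have h3 : u =O[𝓝 0] fun t => t ^ 1 := by
      simpa [h0] using hu.differentiableAt.isBigO_sub
    have h4 : (fun t : ℂ => t ^ n) =O[𝓝 0] fun t => t ^ (n + 1) := by
      refine h2.trans ?_
      refine (((isBigO_refl (fun t : ℂ => t ^ n) (𝓝 0)).mul h3).congr' ?_ ?_)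
      · filter_upwards [hxu] with t ht using ht.symm
      · filter_upwards with t; ring
    have := le_of_pow_isBigO_pow h4
    omega
  obtain ⟨w, hw⟩ := IsAlgClosed.exists_pow_nat_eq (u 0) hn
  have hw0 : w ≠ 0 := by
    rintro rfl
    rw [zero_pow hn.ne'] at hw
    exact hu0 hw.symm
  -- An analytic `n`-th root of the unit `u`: the quotient `u t / u 0` is near 1, where the
  -- principal logarithm is analytic.
  let r : ℂ → ℂ := fun t => w * Complex.exp (Complex.log (u t / u 0) / n)
  have hr : AnalyticAt ℂ r 0 := by
    have h3 : AnalyticAt ℂ (fun t => Complex.log (u t / u 0)) 0 :=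
      (hu.div analyticAt_const hu0).clog (by simp [hu0])
    have h4 : AnalyticAt ℂ (fun t => Complex.log (u t / u 0) / n) 0 :=
      h3.div analyticAt_const (by exact_mod_cast hn.ne')
    exact analyticAt_const.mul h4.cexp
  have hr0 : r 0 = w := by simp [r, hu0]
  have hrn : ∀ᶠ t in 𝓝 0, r t ^ n = u t := by
    filter_upwards [hu.continuousAt.eventually_ne hu0] with t ht
    have hn' : (n : ℂ) ≠ 0 := by exact_mod_cast hn.ne'
    simp only [r]
    rw [mul_pow, ← Complex.exp_nat_mul, mul_div_cancel₀ _ hn', hw, Complex.exp_log (by simp [ht, hu0])]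
    field_simp
  refine ⟨fun t => t * r t, analyticAt_id.mul hr, by simp, ?_, ?_⟩
  · have : HasDerivAt (fun t => t * r t) (1 * r 0 + 0 * deriv r 0) 0 :=
      (hasDerivAt_id 0).mul hr.differentiableAt.hasDerivAt
    rw [this.deriv, hr0]
    simpa using hw0
  · filter_upwards [hrn, hxu] with t h3 h4
    rw [mul_pow, h3, h4]

end PowerSeries

/-! ### Characteristic exponents as broken root-of-unity symmetries. -/

section Symmetry

/-- Modulo `t ^ b`, the germ `f` is invariant under `t ↦ ζ t` for the `d`-th roots of unity `ζ`. -/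
def SymmetricMod (f : ℂ → ℂ) (d b : ℕ) : Prop :=
  ∀ ζ : ℂ, ζ ^ d = 1 → (fun t => f (ζ * t) - f t) =O[𝓝 0] fun t => t ^ b

/-- `b` is the least exponent not divisible by `d` that occurs in the power series of `f`. -/
def IsCharExp (f : ℂ → ℂ) (d b : ℕ) : Prop :=
  SymmetricMod f d b ∧ ¬ SymmetricMod f d (b + 1)

theorem tendsto_const_mul_nhds_zero (ζ : ℂ) : Tendsto (fun t => ζ * t) (𝓝 0) (𝓝 0) := by
  have : Continuous fun t : ℂ => ζ * t := by fun_prop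
  simpa using this.tendsto 0

theorem const_mul_pow_isBigO (ζ : ℂ) (b : ℕ) :
    (fun t : ℂ => (ζ * t) ^ b) =O[𝓝 0] fun t => t ^ b := by
  simp only [mul_pow]
  exact (isBigO_refl _ _).const_mul_left _

theorem SymmetricMod.mono {f : ℂ → ℂ} {d b b' : ℕ} (h : SymmetricMod f d b) (hb : b' ≤ b) :
    SymmetricMod f d b' := fun ζ hζ => (h ζ hζ).trans (pow_isBigO_pow hb)

theorem symmetricMod_one (f : ℂ → ℂ) (b : ℕ) : SymmetricMod f 1 b := by
  intro ζ hζ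
  obtain rfl : ζ = 1 := by simpa using hζ
  simpa using isBigO_zero _ _

theorem symmetricMod_of_isBigO {f : ℂ → ℂ} {b : ℕ} (h : f =O[𝓝 0] fun t => t ^ b) (d : ℕ) :
    SymmetricMod f d b := fun ζ _ =>
  ((h.comp_tendsto (tendsto_const_mul_nhds_zero ζ)).trans (const_mul_pow_isBigO ζ b)).sub h

theorem symmetricMod_congr {f f' : ℂ → ℂ} (h : f =ᶠ[𝓝 0] f') (d b : ℕ) :
    SymmetricMod f d b ↔ SymmetricMod f' d b := by
  refine forall₂_congr fun ζ _ => isBigO_congr ?_ EventuallyEq.rfl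
  filter_upwards [h, (tendsto_const_mul_nhds_zero ζ).eventually h] with t h1 h2
  rw [h1, h2]

/-- The coefficients of `f (ζ t) - f t` are `c k * (ζ ^ k - 1)`, and a primitive `d`-th root of
unity kills the second factor only when `d ∣ k`. -/
theorem symmetricMod_iff_coeff {f : ℂ → ℂ} {c : ℕ → ℂ}
    (h : ∀ᶠ t in 𝓝 (0 : ℂ), HasSum (fun k => c k * t ^ k) (f t)) {d : ℕ} (hd : d ≠ 0) (b : ℕ) :
    SymmetricMod f d b ↔ ∀ k < b, c k ≠ 0 → d ∣ k := by
  have key : ∀ ζ : ℂ, (fun t => f (ζ * t) - f t) =O[𝓝 0] (fun t => t ^ b) ↔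
      ∀ k < b, c k * (ζ ^ k - 1) = 0 := by
    intro ζ
    refine isBigO_pow_iff_coeff_eq_zero ?_ b
    filter_upwards [h, (tendsto_const_mul_nhds_zero ζ).eventually h] with t h1 h2
    refine (h2.sub h1).congr_fun fun k => ?_
    ring
  constructor
  · intro hs k hk hc
    have hp := Complex.isPrimitiveRoot_exp d hd
    have := (key _).1 (hs _ hp.pow_eq_one) k hk
    rw [mul_eq_zero, sub_eq_zero] at this
    exact (hp.pow_eq_one_iff_dvd k).1 (this.resolve_left hc)
  · intro hs ζ hζ
    refine (key ζ).2 fun k hk => ?_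
    by_cases hc : c k = 0
    · simp [hc]
    · obtain ⟨q, rfl⟩ := hs k hk hc
      simp [pow_mul, hζ]

theorem isCharExp_iff_isLeast {f : ℂ → ℂ} {c : ℕ → ℂ}
    (h : ∀ᶠ t in 𝓝 (0 : ℂ), HasSum (fun k => c k * t ^ k) (f t)) {d : ℕ} (hd : d ≠ 0) (b : ℕ) :
    IsCharExp f d b ↔ IsLeast {k : ℕ | c k ≠ 0 ∧ ¬ d ∣ k} b := by
  rw [IsCharExp, symmetricMod_iff_coeff h hd, symmetricMod_iff_coeff h hd]
  constructor
  · rintro ⟨h1, h2⟩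
    push Not at h2
    obtain ⟨k, hk, hc, hkd⟩ := h2
    have : k = b := by
      by_contra hne
      exact hkd (h1 k (by omega) hc)
    subst this
    refine ⟨⟨hc, hkd⟩, fun l hl => ?_⟩
    by_contra! hlt
    exact hl.2 (h1 l hlt hl.1)
  · rintro ⟨⟨hc, hbd⟩, hl⟩
    refine ⟨fun k hk hck => ?_, fun h3 => hbd (h3 b b.lt_succ_self hc)⟩
    by_contra hkd
    exact absurd (hl ⟨hck, hkd⟩) (not_le.2 hk)

theorem IsCharExp.lt_of_not {f : ℂ → ℂ} {d b b' : ℕ} (h : IsCharExp f d b)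
    (h' : ¬ SymmetricMod f d b') : b < b' := by
  by_contra! hle
  exact h' (h.1.mono hle)

theorem IsCharExp.unique {f : ℂ → ℂ} {d b b' : ℕ} (h : IsCharExp f d b)
    (h' : IsCharExp f d b') : b = b' := by
  have h1 := h.lt_of_not h'.2
  have h2 := h'.lt_of_not h.2
  omega

/-- The value at 0 is prescribed because the estimate is on the full neighbourhood filter, and
cancelling `t ^ k` says nothing at `t = 0`. -/
theorem isBigO_of_pow_mul {f : ℂ → ℂ} {k b : ℕ} (h0 : f 0 = 0)
    (h : (fun t => t ^ k * f t) =O[𝓝 0] fun t => t ^ (k + b)) :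
    f =O[𝓝 0] fun t => t ^ b := by
  obtain ⟨K, hK, hKt⟩ := h.exists_nonneg
  refine IsBigO.of_bound K ?_
  filter_upwards [hKt.bound] with t ht
  rcases eq_or_ne t 0 with rfl | hne
  · rw [h0, norm_zero]
    positivity
  · have hpos : 0 < ‖t ^ k‖ := norm_pos_iff.2 (pow_ne_zero _ hne)
    rw [pow_add, norm_mul, norm_mul, mul_left_comm] at ht
    exact le_of_mul_le_mul_left ht hpos

theorem symmetricMod_pow_mul {f h : ℂ → ℂ} {m d : ℕ} (hfh : ∀ᶠ t in 𝓝 0, f t = t ^ m * h t)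
    (hd : d ∣ m) (b : ℕ) : SymmetricMod f d (m + b) ↔ SymmetricMod h d b := by
  refine forall₂_congr fun ζ hζ => ?_
  have hζm : ζ ^ m = 1 := by
    obtain ⟨q, rfl⟩ := hd
    simp [pow_mul, hζ]
  have heq : (fun t => f (ζ * t) - f t) =ᶠ[𝓝 0] fun t => t ^ m * (h (ζ * t) - h t) := by
    filter_upwards [hfh, (tendsto_const_mul_nhds_zero ζ).eventually hfh] with t h1 h2
    rw [h1, h2, mul_pow, hζm]
    ring
  rw [isBigO_congr heq EventuallyEq.rfl]
  constructor
  · exact isBigO_of_pow_mul (by simp)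
  · intro h1
    simp only [pow_add]
    exact (isBigO_refl _ _).mul h1

theorem symmetricMod_sub_const {f : ℂ → ℂ} (a : ℂ) (d b : ℕ) :
    SymmetricMod (fun t => f t - a) d b ↔ SymmetricMod f d b := by
  simp [SymmetricMod]

/-- If `T` is an `n`-th root of `x`, the symmetry of `x` and of `F ∘ T` modulo powers of `t`
passes to `F`. -/
theorem isBigO_symmetry_of_root {T F x : ℂ → ℂ} {n m b c : ℕ} {ζ : ℂ}
    (hT : AnalyticAt ℂ T 0) (hT0 : T 0 = 0) (hTd : deriv T 0 ≠ 0)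
    (hn : 0 < n) (hm : 0 < m) (hTn : ∀ᶠ t in 𝓝 0, T t ^ n = x t) (hζ : ζ ^ n = 1)
    (hF : AnalyticAt ℂ F 0) (hFm : F =O[𝓝 0] fun t => t ^ m) (hnb : n ≤ b)
    (hx : (fun t => x (ζ * t) - x t) =O[𝓝 0] fun t => t ^ b)
    (hFT : (fun t => F (T (ζ * t)) - F (T t)) =O[𝓝 0] fun t => t ^ c) (hc : c + n ≤ b + m) :
    (fun s => F (ζ * s) - F s) =O[𝓝 0] fun s => s ^ c := by
  have hζ0 : ζ ≠ 0 := by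
    rintro rfl
    simp [zero_pow hn.ne'] at hζ
  obtain ⟨S, hS, hS0, -, hTS, -, hmS, hTO, hSO⟩ := exists_local_inverse hT hT0 hTd
  obtain ⟨r, hr, hTr⟩ := (AnalyticAt.isBigO_pow_iff_exists hT 1).1 (by simpa using hTO)
  have hr0 : r 0 ≠ 0 := by
    have h1 : HasDerivAt (fun t => t ^ 1 * r t) (1 * r 0 + 0 * deriv r 0) 0 := by
      simp only [pow_one]
      exact (hasDerivAt_id (0 : ℂ)).mul hr.differentiableAt.hasDerivAt
    rw [(EventuallyEq.deriv_eq hTr), h1.deriv] at hTd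
    simpa using hTd
  have hmul := tendsto_const_mul_nhds_zero ζ
  set A : ℂ → ℂ := fun t => T (ζ * t) with hA
  set B : ℂ → ℂ := fun t => ζ * T t with hB
  set α : ℂ → ℂ := fun t => ζ * r (ζ * t) with hα
  set β : ℂ → ℂ := fun t => ζ * r t with hβ
  have hAα : ∀ᶠ t in 𝓝 0, A t = t * α t := by
    filter_upwards [hmul.eventually hTr] with t ht
    simp only [hA, hα, ht]; ring
  have hBβ : ∀ᶠ t in 𝓝 0, B t = t * β t := by
    filter_upwards [hTr] with t ht
    simp only [hB, hβ, ht]; ring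
  have hβt : Tendsto β (𝓝 0) (𝓝 (ζ * r 0)) := hr.continuousAt.tendsto.const_mul ζ
  have hαt : Tendsto α (𝓝 0) (𝓝 (ζ * r 0)) := (hr.continuousAt.tendsto.comp hmul).const_mul ζ
  have hAt : Tendsto A (𝓝 0) (𝓝 0) := by
    have := hT.continuousAt.tendsto
    rw [hT0] at this
    exact this.comp hmul
  have hBt : Tendsto B (𝓝 0) (𝓝 0) := by
    have := hT.continuousAt.tendsto.const_mul ζ
    rwa [hT0, mul_zero] at this
  have hsum : ∀ k : ℕ, Tendsto (fun t => ∑ i ∈ Finset.range k, α t ^ i * β t ^ (k - 1 - i)) (𝓝 0)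
      (𝓝 (∑ i ∈ Finset.range k, (ζ * r 0) ^ i * (ζ * r 0) ^ (k - 1 - i))) := fun k =>
    tendsto_finsetSum _ fun i _ => (hαt.pow i).mul (hβt.pow _)
  have hgeom : ∀ k : ℕ, 0 < k → ∀ᶠ t in 𝓝 0, A t ^ k - B t ^ k =
      t ^ (k - 1) * (A t - B t) * ∑ i ∈ Finset.range k, α t ^ i * β t ^ (k - 1 - i) := by
    intro k hk
    filter_upwards [hAα, hBβ] with t h1 h2
    rw [h1, h2, mul_pow t (α t), mul_pow t (β t), ← mul_sub, ← geom_sum₂_mul]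
    obtain ⟨k, rfl⟩ := Nat.exists_eq_add_of_lt hk
    simp only [zero_add, Nat.add_sub_cancel]
    ring
  -- Factor `A ^ n - B ^ n`: the geometric sum is `t ^ (n - 1)` times a function with nonzero limit
  -- `n (ζ r(0)) ^ (n - 1)`, so dividing by it costs exactly `n - 1` orders.
  have hAB : (fun t => A t - B t) =O[𝓝 0] fun t => t ^ (b - (n - 1)) := by
    refine isBigO_of_pow_mul (k := n - 1) (by simp [hA, hB, hT0]) ?_
    rw [Nat.add_sub_cancel' (by omega : n - 1 ≤ b)]
    have h1 : (fun t => A t ^ n - B t ^ n) =O[𝓝 0] fun t => t ^ b := by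
      refine hx.congr' ?_ EventuallyEq.rfl
      filter_upwards [hTn, hmul.eventually hTn] with t h1 h2
      simp only [hA, hB, mul_pow, h1, h2, hζ, one_mul]
    have hne : (∑ i ∈ Finset.range n, (ζ * r 0) ^ i * (ζ * r 0) ^ (n - 1 - i)) ≠ 0 := by
      rw [Finset.sum_congr rfl (g := fun _ => (ζ * r 0) ^ (n - 1))]
      · simp [hn.ne', hζ0, hr0]
      · intro i hi
        rw [← pow_add]
        congr 1
        have := Finset.mem_range.1 hi
        omega
    have h2 : (fun _ : ℂ => (1 : ℂ)) =O[𝓝 0]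
        fun t => ∑ i ∈ Finset.range n, α t ^ i * β t ^ (n - 1 - i) :=
      (isBigO_const_left_iff_pos_le_norm one_ne_zero).2
        ⟨_, half_pos (norm_pos_iff.2 hne), ((hsum n).norm.eventually
          (lt_mem_nhds (half_lt_self (norm_pos_iff.2 hne)))).mono fun _ h => h.le⟩
    have h3 := (isBigO_refl (fun t => t ^ (n - 1) * (A t - B t)) (𝓝 0)).mul h2
    simp only [mul_one] at h3
    refine h3.trans (h1.congr' (hgeom n hn) EventuallyEq.rfl)
  obtain ⟨G, hG, hFG⟩ := (AnalyticAt.isBigO_pow_iff_exists hF m).1 hFm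
  have hGO : (fun t => G (A t) - G (B t)) =O[𝓝 0] fun t => A t - B t := by
    have h1 := hG.hasStrictDerivAt.hasStrictFDerivAt.isBigO_sub
    rw [nhds_prod_eq] at h1
    exact h1.comp_tendsto (hAt.prodMk hBt)
  -- Since `F s = s ^ m G s`, the factor `s ^ m` gives back at least `m - 1` orders; the total `b -
  -- (n - 1) + (m - 1)` is at least `c` by `hc`.
  have hFAB : (fun t => F (A t) - F (B t)) =O[𝓝 0] fun t => t ^ c := by
    have h1 : (fun t => A t ^ m - B t ^ m) =O[𝓝 0] fun t => t ^ c := by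
      have h2 : (fun t => ∑ i ∈ Finset.range m, α t ^ i * β t ^ (m - 1 - i)) =O[𝓝 0]
          fun _ => (1 : ℂ) := by
        simpa using (hsum m).norm.isBoundedUnder_le
      have h3 := (((isBigO_refl (fun t : ℂ => t ^ (m - 1)) (𝓝 0)).mul hAB).mul h2).congr'
        (EventuallyEq.symm (hgeom m hm)) EventuallyEq.rfl
      refine h3.trans ?_
      simp only [mul_one, ← pow_add]
      exact pow_isBigO_pow (by omega)
    have h4 : (fun t => G (A t)) =O[𝓝 0] fun _ => (1 : ℂ) := by
      have := (hG.continuousAt.tendsto.comp hAt).norm.isBoundedUnder_le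
      simpa using this
    have h5 : (fun t => B t ^ m) =O[𝓝 0] fun t => t ^ m :=
      ((hTO.const_mul_left ζ).pow m)
    have h6 := (h1.mul h4).add (((h5.mul (hGO.trans hAB))).trans
      (show (fun t : ℂ => t ^ m * t ^ (b - (n - 1))) =O[𝓝 0] fun t => t ^ c * 1 by
        simp only [mul_one, ← pow_add]
        exact pow_isBigO_pow (by omega)))
    simp only [mul_one] at h6
    refine h6.congr' ?_ EventuallyEq.rfl
    filter_upwards [hAt.eventually hFG, hBt.eventually hFG] with t h7 h8
    rw [h7, h8]
    ring
  have hfin : (fun t => F (ζ * T t) - F (T t)) =O[𝓝 0] fun t => t ^ c :=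
    (hFT.sub hFAB).congr_left fun t => by simp only [hA, hB]; ring
  have hSt : Tendsto S (𝓝 0) (𝓝 0) := hmS.le
  refine ((hfin.comp_tendsto hSt).trans (hSO.pow c)).congr' ?_ EventuallyEq.rfl
  filter_upwards [hTS] with s hs
  simp [hs]

end Symmetry

/-! ### Transport of symmetries under coordinate changes and interchange. -/

section Transfer

theorem AnalyticAt.comp_sub_isBigO {φ : ℂ × ℂ → ℂ × ℂ} (hφ : AnalyticAt ℂ φ 0)
    {a b : ℂ → ℂ × ℂ} (ha : Tendsto a (𝓝 0) (𝓝 0)) (hb : Tendsto b (𝓝 0) (𝓝 0)) :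
    (fun t => φ (a t) - φ (b t)) =O[𝓝 0] fun t => a t - b t := by
  have h := hφ.hasStrictFDerivAt.isBigO_sub
  rw [nhds_prod_eq] at h
  exact h.comp_tendsto (ha.prodMk hb)

/-- Every small number has a small `n`-th root. This lets an identity known after the substitution
`t = r ^ n` descend to `t`. -/
theorem map_pow_nhds_zero {n : ℕ} (hn : 0 < n) : map (fun t : ℂ => t ^ n) (𝓝 0) = 𝓝 0 := by
  refine le_antisymm ?_ ?_
  · have : Continuous fun t : ℂ => t ^ n := by fun_prop
    have h := this.tendsto 0
    rwa [zero_pow hn.ne'] at h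
  · intro U hU
    obtain ⟨δ, hδ, hUδ⟩ := Metric.mem_nhds_iff.1 (mem_map.1 hU)
    filter_upwards [Metric.ball_mem_nhds (0 : ℂ) (pow_pos hδ n)] with w hw
    obtain ⟨r, rfl⟩ := IsAlgClosed.exists_pow_nat_eq w hn
    refine hUδ ?_
    simp only [Metric.mem_ball, dist_zero_right, norm_pow] at hw ⊢
    exact lt_of_pow_lt_pow_left₀ n hδ.le hw

theorem tendsto_pow_prodMk {f : ℂ → ℂ} {m : ℕ} (hm : 0 < m) (hfm : f =O[𝓝 0] fun t => t ^ m) :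
    Tendsto (fun t => (t ^ m, f t)) (𝓝 0) (𝓝 (0 : ℂ × ℂ)) := by
  have h1 : Tendsto (fun t : ℂ => t ^ m) (𝓝 0) (𝓝 0) := (map_pow_nhds_zero hm).le
  exact (h1.prodMk_nhds (hfm.trans_tendsto h1))

theorem prodMk_isBigO_pow {f : ℂ → ℂ} {m : ℕ} (hfm : f =O[𝓝 0] fun t => t ^ m) :
    (fun t => (t ^ m, f t)) =O[𝓝 0] fun t => t ^ m := (isBigO_refl _ _).prod_left hfm

/-- The symmetries of a parametrization are carried along by a change of coordinates. -/
theorem SymmetricMod.transfer {f f' T : ℂ → ℂ} {φ : ℂ × ℂ → ℂ × ℂ} {m d b : ℕ}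
    (hφ : AnalyticAt ℂ φ 0) (hT : AnalyticAt ℂ T 0) (hT0 : T 0 = 0) (hTd : deriv T 0 ≠ 0)
    (hm : 0 < m) (h : ∀ᶠ t in 𝓝 0, φ (t ^ m, f t) = (T t ^ m, f' (T t)))
    (hfm : f =O[𝓝 0] fun t => t ^ m) (hf' : AnalyticAt ℂ f' 0)
    (hfm' : f' =O[𝓝 0] fun t => t ^ m) (hd : d ∣ m) (hs : SymmetricMod f d b) :
    SymmetricMod f' d b := by
  -- Below `m` the order of `f'` alone gives the symmetry; the root lemma needs `m ≤ b`.
  rcases lt_or_ge b m with hbm | hbm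
  · exact (symmetricMod_of_isBigO hfm' d).mono hbm.le
  intro ζ hζ
  have hζm : ζ ^ m = 1 := by
    obtain ⟨q, rfl⟩ := hd
    simp [pow_mul, hζ]
  have hg := tendsto_pow_prodMk hm hfm
  have hmul := tendsto_const_mul_nhds_zero ζ
  have h1 : (fun t => φ ((ζ * t) ^ m, f (ζ * t)) - φ (t ^ m, f t)) =O[𝓝 0] fun t => t ^ b := by
    refine (AnalyticAt.comp_sub_isBigO hφ (hg.comp hmul) hg).trans ?_
    have h2 := (isBigO_zero (E' := ℂ) (fun t : ℂ => t ^ b) (𝓝 (0 : ℂ))).prod_left (hs ζ hζ)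
    refine h2.congr_left fun t => ?_
    simp [mul_pow, hζm]
  have h3 : (fun t => (T (ζ * t) ^ m - T t ^ m, f' (T (ζ * t)) - f' (T t))) =O[𝓝 0]
      fun t => t ^ b := by
    refine h1.congr' ?_ EventuallyEq.rfl
    filter_upwards [h, hmul.eventually h] with t h4 h5
    rw [h4, h5, Prod.mk_sub_mk]
  exact isBigO_symmetry_of_root (x := fun t => T t ^ m) hT hT0 hTd hm hm (by simp) hζm hf' hfm'
    hbm (isBigO_fst_prod.trans h3) (isBigO_snd_prod.trans h3) le_rfl

/-- The symmetries of a parametrization when the two coordinates are interchanged. -/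
theorem SymmetricMod.inversion {Y F T : ℂ → ℂ} {m n d k : ℕ}
    (hT : AnalyticAt ℂ T 0) (hT0 : T 0 = 0) (hTd : deriv T 0 ≠ 0)
    (hm : 0 < m) (hn : 0 < n) (hTn : ∀ᶠ t in 𝓝 0, T t ^ n = Y t)
    (hF : AnalyticAt ℂ F 0) (hFm : F =O[𝓝 0] fun t => t ^ m)
    (hFT : ∀ᶠ t in 𝓝 0, F (T t) = t ^ m) (hdm : d ∣ m) (hdn : d ∣ n)
    (hs : SymmetricMod Y d (n + k)) : SymmetricMod F d (m + k) := by
  intro ζ hζ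
  have hζp : ∀ m, d ∣ m → ζ ^ m = 1 := by
    rintro _ ⟨q, rfl⟩
    simp [pow_mul, hζ]
  refine isBigO_symmetry_of_root hT hT0 hTd hn hm hTn (hζp n hdn) hF hFm (n.le_add_right k)
    (hs ζ hζ) ?_ (by omega)
  refine (isBigO_zero _ _).congr' ?_ EventuallyEq.rfl
  filter_upwards [hFT, (tendsto_const_mul_nhds_zero ζ).eventually hFT] with t h1 h2
  rw [h1, h2, mul_pow, hζp m hdm]
  simp

end Transfer

/-! ### Parametrized germs as equalities of filters, and their uniqueness. -/

section Germs

variable {X : Type*} [TopologicalSpace X] [ChartedSpace (ℂ × ℂ) X]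

/-- The chart `e` of the maximal atlas is centred at `P`. -/
structure IsCentredChart (e : OpenPartialHomeomorph X (ℂ × ℂ)) (P : X) : Prop where
  chart : e ∈ IsManifold.maximalAtlas 𝓘(ℂ, ℂ × ℂ) ω X
  mem_source : P ∈ e.source
  centred : e P = 0

/-- In the chart `e`, the germ of `C` at `P` is the image of the analytic germ `g`. -/
structure IsParamGerm (C : Set X) (P : X) (e : OpenPartialHomeomorph X (ℂ × ℂ))
    (g : ℂ → ℂ × ℂ) : Prop where
  centred : IsCentredChart e P
  analyticAt : AnalyticAt ℂ g 0
  map_eq : map e (𝓝[C] P) = map g (𝓝 0)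

/-- The germ of `C` at `P` is parametrized by `t ↦ (t ^ m, f t)` with `f` of order at least `m`. -/
structure IsPuiseuxGerm (C : Set X) (P : X) (e : OpenPartialHomeomorph X (ℂ × ℂ)) (m : ℕ)
    (f : ℂ → ℂ) : Prop where
  germ : IsParamGerm C P e fun t => (t ^ m, f t)
  m_pos : 0 < m
  isBigO : f =O[𝓝 0] fun t => t ^ m

variable {C : Set X} {P : X} {e e' : OpenPartialHomeomorph X (ℂ × ℂ)}

theorem IsCentredChart.transition (he : IsCentredChart e P) (he' : IsCentredChart e' P) :
    AnalyticAt ℂ (fun p => e' (e.symm p)) 0 := by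
  have h1 := (contDiffGroupoid ω 𝓘(ℂ, ℂ × ℂ)).compatible_of_mem_maximalAtlas he.chart he'.chart
  have h2 := contMDiffOn_iff_contDiffOn.1 (contMDiffOn_of_mem_contDiffGroupoid h1)
  have h0 : (0 : ℂ × ℂ) ∈ (e.symm.trans e').source := by
    have h3 : (0 : ℂ × ℂ) ∈ e.target := he.centred ▸ e.map_source he.mem_source
    have h4 : e.symm 0 = P := he.centred ▸ e.left_inv he.mem_source
    simp [h3, h4, he'.mem_source]
  exact (h2.contDiffAt ((e.symm.trans e').open_source.mem_nhds h0)).analyticAt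

theorem IsCentredChart.zero_mem_target (he : IsCentredChart e P) : (0 : ℂ × ℂ) ∈ e.target :=
  he.centred ▸ e.map_source he.mem_source

theorem IsCentredChart.symm_zero (he : IsCentredChart e P) : e.symm 0 = P :=
  he.centred ▸ e.left_inv he.mem_source

theorem IsCentredChart.tendsto_symm (he : IsCentredChart e P) : Tendsto e.symm (𝓝 0) (𝓝 P) := by
  have := e.tendsto_symm he.mem_source
  rwa [he.centred] at this

theorem IsCentredChart.tendsto (he : IsCentredChart e P) : Tendsto e (𝓝 P) (𝓝 0) := by
  have := (e.continuousAt he.mem_source).tendsto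
  rwa [he.centred] at this

theorem IsCentredChart.eventually_inverse (he : IsCentredChart e P) (he' : IsCentredChart e' P) :
    ∀ᶠ p in 𝓝 (0 : ℂ × ℂ), e (e'.symm (e' (e.symm p))) = p := by
  filter_upwards [he.tendsto_symm.eventually (e'.open_source.mem_nhds he'.mem_source),
    e.open_target.mem_nhds he.zero_mem_target] with p h1 h2
  rw [e'.left_inv h1, e.right_inv h2]

theorem IsParamGerm.tendsto {g : ℂ → ℂ × ℂ} (h : IsParamGerm C P e g) :
    Tendsto g (𝓝 0) (𝓝 0) := by
  rw [Tendsto, ← h.map_eq]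
  exact h.centred.tendsto.mono_left nhdsWithin_le_nhds

theorem IsParamGerm.congr {g g' : ℂ → ℂ × ℂ} (h : IsParamGerm C P e g) (hg : g =ᶠ[𝓝 0] g') :
    IsParamGerm C P e g' :=
  ⟨h.centred, h.analyticAt.congr hg, h.map_eq.trans (map_congr hg)⟩

theorem IsParamGerm.comp {g : ℂ → ℂ × ℂ} {S : ℂ → ℂ} (h : IsParamGerm C P e g)
    (hS : AnalyticAt ℂ S 0) (hS0 : S 0 = 0) (hmap : map S (𝓝 0) = 𝓝 0) :
    IsParamGerm C P e (fun s => g (S s)) := by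
  refine ⟨h.centred, ?_, ?_⟩
  · have := h.analyticAt
    rw [← hS0] at this
    exact this.comp hS
  · rw [h.map_eq]
    conv_lhs => rw [← hmap]
    rfl

theorem IsParamGerm.change_chart {g : ℂ → ℂ × ℂ} (h : IsParamGerm C P e g)
    (he' : IsCentredChart e' P) : IsParamGerm C P e' (fun t => e' (e.symm (g t))) := by
  refine ⟨he', ?_, ?_⟩
  · have h1 := h.centred.transition he'
    have h0 : g 0 = 0 := tendsto_nhds_unique h.analyticAt.continuousAt.tendsto h.tendsto
    rw [← h0] at h1
    exact h1.comp h.analyticAt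
  · have h1 : e' =ᶠ[𝓝[C] P] (e' ∘ e.symm) ∘ e := by
      filter_upwards [mem_nhdsWithin_of_mem_nhds (e.open_source.mem_nhds h.centred.mem_source)]
        with Q hQ
      simp [e.left_inv hQ]
    rw [map_congr h1, ← Filter.map_map, h.map_eq]
    rfl

/-- A parametrization whose first coordinate vanishes to the exact order `n` can be normalized. -/
theorem IsParamGerm.normalize {g : ℂ → ℂ × ℂ} {n : ℕ} (h : IsParamGerm C P e g) (hn : 0 < n)
    (h1 : g =O[𝓝 0] fun t => t ^ n) (h2 : (fun t => t ^ n) =O[𝓝 0] fun t => (g t).1) :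
    ∃ T S : ℂ → ℂ, AnalyticAt ℂ T 0 ∧ T 0 = 0 ∧ deriv T 0 ≠ 0 ∧
      AnalyticAt ℂ S 0 ∧ S 0 = 0 ∧ deriv S 0 ≠ 0 ∧
      (∀ᶠ t in 𝓝 0, S (T t) = t) ∧ (∀ᶠ s in 𝓝 0, T (S s) = s) ∧
      (∀ᶠ t in 𝓝 0, T t ^ n = (g t).1) ∧ (S =O[𝓝 0] fun t => t) ∧
      IsPuiseuxGerm C P e n fun s => (g (S s)).2 := by
  have hx : AnalyticAt ℂ (fun t => (g t).1) 0 := analyticAt_fst.comp h.analyticAt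
  obtain ⟨T, hT, hT0, hTd, hTn⟩ := exists_root_of_exact_order hn hx (isBigO_fst_prod.trans h1) h2
  obtain ⟨S, hS, hS0, hST, hTS, hmT, hmS, hTO, hSO⟩ := exists_local_inverse hT hT0 hTd
  have hSt : Tendsto S (𝓝 0) (𝓝 0) := hmS.le
  have hSd : deriv S 0 ≠ 0 := by
    intro hd
    have h3 : HasDerivAt (fun s => T (S s)) (deriv T 0 * deriv S 0) 0 := by
      have h4 := hT.differentiableAt.hasDerivAt
      rw [← hS0] at h4
      have := h4.comp 0 hS.differentiableAt.hasDerivAt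
      rwa [hS0] at this
    have h5 : deriv (fun s => T (S s)) 0 = 1 := by
      rw [EventuallyEq.deriv_eq (show (fun s => T (S s)) =ᶠ[𝓝 0] id from hTS)]
      simp
    rw [h3.deriv, hd, mul_zero] at h5
    exact zero_ne_one h5
  refine ⟨T, S, hT, hT0, hTd, hS, hS0, hSd, hST, hTS, hTn, hSO, ?_, hn, ?_⟩
  · refine (h.comp hS hS0 hmS).congr ?_
    filter_upwards [hSt.eventually hTn, hTS] with s h3 h4
    rw [h4] at h3
    rw [h3]
  · exact ((isBigO_snd_prod.trans h1).comp_tendsto hSt).trans (hSO.pow n)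

theorem IsPuiseuxGerm.analyticAt {m : ℕ} {f : ℂ → ℂ} (h : IsPuiseuxGerm C P e m f) :
    AnalyticAt ℂ f 0 := analyticAt_snd.comp h.germ.analyticAt

/-- Passing to another chart whose first coordinate is not tangent to the curve. -/
theorem IsPuiseuxGerm.change_chart {m : ℕ} {f : ℂ → ℂ} (h : IsPuiseuxGerm C P e m f)
    (he' : IsCentredChart e' P)
    (ht : (fun t => t ^ m) =O[𝓝 0] fun t => (e' (e.symm (t ^ m, f t))).1) :
    ∃ f', IsPuiseuxGerm C P e' m f' ∧
      ∀ d, d ∣ m → ∀ b, SymmetricMod f d b ↔ SymmetricMod f' d b := by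
  have hφ := h.germ.centred.transition he'
  have hψ := he'.transition h.germ.centred
  have hφ0 : e' (e.symm 0) = 0 := by rw [h.germ.centred.symm_zero, he'.centred]
  have h1 : (fun t => e' (e.symm (t ^ m, f t))) =O[𝓝 0] fun t => t ^ m := by
    have := AnalyticAt.comp_sub_isBigO hφ h.germ.tendsto (tendsto_const_nhds (x := (0 : ℂ × ℂ)))
    simp only [hφ0, sub_zero] at this
    exact this.trans (prodMk_isBigO_pow h.isBigO)
  obtain ⟨T, S, hT, hT0, hTd, hS, hS0, hSd, hST, hTS, hTn, hSO, h2⟩ :=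
    (h.germ.change_chart he').normalize h.m_pos h1 ht
  have hTt : Tendsto T (𝓝 0) (𝓝 0) := by simpa [hT0] using hT.continuousAt.tendsto
  have hSt : Tendsto S (𝓝 0) (𝓝 0) := by simpa [hS0] using hS.continuousAt.tendsto
  have h3 : ∀ᶠ t in 𝓝 0, e' (e.symm (t ^ m, f t)) =
      (T t ^ m, (e' (e.symm (S (T t) ^ m, f (S (T t))))).2) := by
    filter_upwards [hST, hTn] with t h4 h5
    rw [h4, h5]
  refine ⟨_, h2, fun d hd b => ⟨fun hs => hs.transfer hφ hT hT0 hTd h.m_pos h3 h.isBigO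
    h2.analyticAt h2.isBigO hd, fun hs => hs.transfer hψ hS hS0 hSd h.m_pos ?_ h2.isBigO
    h.analyticAt h.isBigO hd⟩⟩
  filter_upwards [hSt.eventually h3, hTS, (h.germ.tendsto.comp hSt).eventually
    (h.germ.centred.eventually_inverse he')] with s h4 h5 h6
  simp only [h5] at h4
  rw [← h4]
  exact h6

/-- The parametrization with exponent `m` and series `f` is not a power of another one. -/
def IsPrimitiveSeries (f : ℂ → ℂ) (m : ℕ) : Prop :=
  ∀ d, d ∣ m → (∀ b, SymmetricMod f d b) → d = 1

/-- Replacing `r` by `η r` with `η ^ m = 1` leaves the right side fixed, so `f` is invariant under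
`η ^ n`. Primitivity forces `η ^ n = 1` for a primitive `m`-th root `η`. -/
theorem dvd_of_eventually_eq_comp_pow {f h : ℂ → ℂ} {m n : ℕ} (hm : 0 < m) (hn : 0 < n)
    (hp : IsPrimitiveSeries f m) (hfh : ∀ᶠ r in 𝓝 0, f (r ^ n) = h (r ^ m)) : m ∣ n := by
  have hη := Complex.isPrimitiveRoot_exp m hm.ne'
  set η := Complex.exp (2 * Real.pi * Complex.I / m)
  have hd : orderOf (η ^ n) = 1 := by
    refine hp _ ?_ fun b ζ hζ => ?_
    · rw [orderOf_dvd_iff_pow_eq_one, ← pow_mul, mul_comm, pow_mul, hη.pow_eq_one, one_pow]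
    · have : NeZero (orderOf (η ^ n)) := ⟨by
        rw [orderOf_ne_zero_iff, isOfFinOrder_iff_pow_eq_one]
        exact ⟨m, hm, by rw [← pow_mul, mul_comm, pow_mul, hη.pow_eq_one, one_pow]⟩⟩
      obtain ⟨i, -, rfl⟩ := (IsPrimitiveRoot.orderOf (η ^ n)).eq_pow_of_pow_eq_one hζ
      refine (isBigO_zero _ _).congr' ?_ EventuallyEq.rfl
      have h1 : ∀ᶠ r in 𝓝 (0 : ℂ), f ((η ^ n) ^ i * r ^ n) = f (r ^ n) := by
        filter_upwards [hfh, (tendsto_const_mul_nhds_zero (η ^ i)).eventually hfh] with r h1 h2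
        rw [h1, ← pow_mul, mul_comm n i, pow_mul, ← mul_pow, h2, mul_pow, ← pow_mul, mul_comm i m,
          pow_mul, hη.pow_eq_one, one_pow, one_mul]
      have h2 : ∀ᶠ t in map (fun r : ℂ => r ^ n) (𝓝 0), f ((η ^ n) ^ i * t) = f t := h1
      rw [map_pow_nhds_zero hn] at h2
      filter_upwards [h2] with t ht
      rw [ht]
      simp
  rw [orderOf_eq_one_iff] at hd
  exact (hη.pow_eq_one_iff_dvd n).1 hd

/-- Put `s = r ^ m'`: the point with parameter `s` has second parameter `ζ r ^ m` for some `m'`-th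
root of unity `ζ` depending on `r`. Finitely many `ζ` are available, so one occurs for `r`
accumulating at 0, and the identity theorem makes the relation hold near 0. Primitivity of each
series then gives both divisibilities between `m` and `m'`. -/
theorem IsPuiseuxGerm.unique_same_chart {m m' : ℕ} {f f' : ℂ → ℂ} (h : IsPuiseuxGerm C P e m f)
    (h' : IsPuiseuxGerm C P e m' f') (hp : IsPrimitiveSeries f m) (hp' : IsPrimitiveSeries f' m') :
    m = m' ∧ ∀ d b, SymmetricMod f d b ↔ SymmetricMod f' d b := by
  have hm := h.m_pos
  have hm' := h'.m_pos
  have hmap := h.germ.map_eq.symm.trans h'.germ.map_eq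
  have h1 : ∀ᶠ s in 𝓝 (0 : ℂ), ∃ t, (t ^ m', f' t) = (s ^ m, f s) := by
    have : Set.range (fun t => (t ^ m', f' t)) ∈ map (fun t => (t ^ m', f' t)) (𝓝 (0 : ℂ)) :=
      range_mem_map
    rw [← hmap] at this
    exact this
  have hpow : Tendsto (fun r : ℂ => r ^ m') (𝓝 0) (𝓝 0) := (map_pow_nhds_zero hm').le
  have hpow' : Tendsto (fun r : ℂ => r ^ m) (𝓝 0) (𝓝 0) := (map_pow_nhds_zero hm).le
  have h2 : ∀ᶠ r in 𝓝[≠] (0 : ℂ), ∃ ζ ∈ Polynomial.nthRootsFinset m' (1 : ℂ),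
      f (r ^ m') = f' (ζ * r ^ m) := by
    filter_upwards [(hpow.eventually h1).filter_mono nhdsWithin_le_nhds, self_mem_nhdsWithin]
      with r ⟨t, ht⟩ hr
    have hr0 : r ^ m ≠ 0 := pow_ne_zero _ hr
    obtain ⟨h3, h4⟩ := Prod.mk.inj ht
    refine ⟨t / r ^ m, ?_, ?_⟩
    · rw [Polynomial.mem_nthRootsFinset hm', div_pow, h3, ← pow_mul, ← pow_mul, mul_comm]
      exact div_self (pow_ne_zero _ hr)
    · rw [div_mul_cancel₀ _ hr0, h4]
  obtain ⟨ζ, hζ, h3⟩ : ∃ ζ ∈ Polynomial.nthRootsFinset m' (1 : ℂ),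
      ∃ᶠ r in 𝓝[≠] (0 : ℂ), f (r ^ m') = f' (ζ * r ^ m) := by
    by_contra! hcon
    have h4 : ∀ᶠ r in 𝓝[≠] (0 : ℂ), ∀ ζ ∈ Polynomial.nthRootsFinset m' (1 : ℂ),
        ¬ f (r ^ m') = f' (ζ * r ^ m) :=
      (eventually_all_finset _).2 fun ζ hζ => by simpa using hcon ζ hζ
    obtain ⟨r, ⟨ζ, hζ, h5⟩, h6⟩ := (h2.and h4).exists
    exact h6 ζ hζ h5
  rw [Polynomial.mem_nthRootsFinset hm'] at hζ
  have hζ0 : ζ ≠ 0 := by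
    rintro rfl
    simp [zero_pow hm'.ne'] at hζ
  have h5 : ∀ᶠ r in 𝓝 (0 : ℂ), f (r ^ m') = f' (ζ * r ^ m) := by
    refine (AnalyticAt.frequently_eq_iff_eventually_eq ?_ ?_).1 h3
    · have h6 := h.analyticAt
      have h7 : (0 : ℂ) = (0 : ℂ) ^ m' := (zero_pow hm'.ne').symm
      rw [h7] at h6
      exact AnalyticAt.fun_comp (f := fun r : ℂ => r ^ m') h6 (analyticAt_id.pow m')
    · have h6 := h'.analyticAt
      have h7 : (0 : ℂ) = ζ * (0 : ℂ) ^ m := by simp [hm.ne']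
      rw [h7] at h6
      exact AnalyticAt.fun_comp (f := fun r : ℂ => ζ * r ^ m) h6
        (analyticAt_const.mul (analyticAt_id.pow m))
  have hd1 : m ∣ m' := dvd_of_eventually_eq_comp_pow (h := fun s => f' (ζ * s)) hm hm' hp h5
  have hd2 : m' ∣ m := by
    obtain ⟨ξ, hξ⟩ := IsAlgClosed.exists_pow_nat_eq ζ⁻¹ hm
    refine dvd_of_eventually_eq_comp_pow (h := fun s => f (ξ ^ m' * s)) hm' hm hp' ?_
    filter_upwards [(tendsto_const_mul_nhds_zero ξ).eventually h5] with r h6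
    rw [mul_pow, mul_pow, hξ, ← mul_assoc, mul_inv_cancel₀ hζ0, one_mul] at h6
    exact h6.symm
  obtain rfl := Nat.dvd_antisymm hd1 hd2
  refine ⟨rfl, fun d b => ?_⟩
  have h6 : ∀ᶠ s in 𝓝 (0 : ℂ), f s = f' (ζ * s) := by
    have h7 : ∀ᶠ s in map (fun r : ℂ => r ^ m) (𝓝 0), f s = f' (ζ * s) := h5
    rwa [map_pow_nhds_zero hm] at h7
  rw [symmetricMod_congr h6]
  have key : ∀ (F : ℂ → ℂ) (ζ : ℂ), SymmetricMod F d b → SymmetricMod (fun s => F (ζ * s)) d b := by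
    intro F ζ hF η hη
    refine (((hF η hη).comp_tendsto (tendsto_const_mul_nhds_zero ζ)).trans
      (const_mul_pow_isBigO ζ b)).congr_left fun t => ?_
    simp [mul_left_comm]
  refine ⟨fun hs => ?_, key f' ζ⟩
  have := key _ ζ⁻¹ hs
  simpa [mul_inv_cancel_left₀ hζ0] using this

/-- Two primitive parametrizations of a germ, in arbitrary charts, have the same exponent `m` and
the same symmetries. -/
theorem IsPuiseuxGerm.unique {m m' : ℕ} {f f' : ℂ → ℂ} (h : IsPuiseuxGerm C P e m f)
    (h' : IsPuiseuxGerm C P e' m' f') (hp : IsPrimitiveSeries f m)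
    (hp' : IsPrimitiveSeries f' m') :
    m = m' ∧ ∀ d, d ∣ m → ∀ b, SymmetricMod f d b ↔ SymmetricMod f' d b := by
  have he := h.germ.centred
  have he' := h'.germ.centred
  have hφ := h.germ.change_chart he'
  -- That the first coordinate of `e'` dominates is a property of the set germ. It is read off the
  -- second parametrization and carried to the first through the equality of filters.
  have ht : (fun t => t ^ m) =O[𝓝 0] fun t => (e' (e.symm (t ^ m, f t))).1 := by
    have h1 : (fun p : ℂ × ℂ => p) =O[map (fun t => e' (e.symm (t ^ m, f t))) (𝓝 0)]
        fun p => p.1 := by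
      rw [← hφ.map_eq, h'.germ.map_eq, isBigO_map]
      exact (isBigO_refl _ _).prod_left h'.isBigO
    have h2 : (fun t => e (e'.symm (e' (e.symm (t ^ m, f t))))) =O[𝓝 0]
        fun t => e' (e.symm (t ^ m, f t)) := by
      have h3 := AnalyticAt.comp_sub_isBigO (he'.transition he) hφ.tendsto
        (tendsto_const_nhds (x := (0 : ℂ × ℂ)))
      simpa [he'.symm_zero, he.centred] using h3
    have h3 : (fun t => (t ^ m, f t)) =O[𝓝 0] fun t => e' (e.symm (t ^ m, f t)) := by
      refine h2.congr' ?_ EventuallyEq.rfl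
      exact h.germ.tendsto.eventually (he.eventually_inverse he')
    exact (isBigO_fst_prod.trans h3).trans (isBigO_map.1 h1)
  obtain ⟨f₁, h₁, hs⟩ := h.change_chart he' ht
  have hp₁ : IsPrimitiveSeries f₁ m := fun d hd hb => hp d hd fun b => (hs d hd b).2 (hb b)
  obtain ⟨rfl, h2⟩ := h₁.unique_same_chart h' hp₁ hp'
  exact ⟨rfl, fun d hd b => (hs d hd b).trans (h2 d b)⟩

end Germs

/-! ### Divisibility in the sequence m_j. -/

theorem gcdSeq_succ (m : ℕ) (β : ℕ → ℕ) {j : ℕ} (hj : 1 ≤ j) :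
    gcdSeq m β (j + 1) = Nat.gcd (gcdSeq m β j) (β j) := by
  obtain ⟨j, rfl⟩ := Nat.exists_eq_add_of_le' hj
  rfl

theorem gcdSeq_dvd_of_le (m : ℕ) (β : ℕ → ℕ) {i j : ℕ} (hi : 1 ≤ i) (hij : i ≤ j) :
    gcdSeq m β j ∣ gcdSeq m β i := by
  induction j, hij using Nat.le_induction with
  | base => exact dvd_rfl
  | succ j hj ih =>
    rw [gcdSeq_succ m β (hi.trans hj)]
    exact (Nat.gcd_dvd_left _ _).trans ih

theorem gcdSeq_dvd (m : ℕ) (β : ℕ → ℕ) (j : ℕ) : gcdSeq m β j ∣ m := by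
  rcases Nat.eq_zero_or_pos j with rfl | hj
  · exact dvd_rfl
  · exact gcdSeq_dvd_of_le m β le_rfl hj

theorem gcdSeq_ne_zero {m : ℕ} (hm : 0 < m) (β : ℕ → ℕ) (j : ℕ) : gcdSeq m β j ≠ 0 :=
  (Nat.pos_of_dvd_of_pos (gcdSeq_dvd m β j) hm).ne'

/-! ### Translation between power-series parametrizations and symmetries. -/

section Parametrization

variable {X : Type*} [TopologicalSpace X] [ChartedSpace (ℂ × ℂ) X]
variable {C : Set X} {P : X} {e : OpenPartialHomeomorph X (ℂ × ℂ)}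

theorem eventually_exists_hasSum {f : ℂ → ℂ} (hf : AnalyticAt ℂ f 0) :
    ∃ (c : ℕ → ℂ) (ε : ℝ), 0 < ε ∧ ∀ t : ℂ, ‖t‖ < ε → HasSum (fun k => c k * t ^ k) (f t) := by
  obtain ⟨p, hp⟩ := hf
  have h1 := hasFPowerSeriesAt_iff.1 hp
  obtain ⟨ε, hε, h2⟩ := Metric.eventually_nhds_iff.1 h1
  refine ⟨p.coeff, ε, hε, fun t ht => ?_⟩
  have h3 := @h2 t (by simpa using ht)
  simpa [mul_comm] using h3

theorem norm_lt_of_norm_pow_lt {t : ℂ} {m : ℕ} {δ : ℝ} (hδ : 0 < δ) (h : ‖t ^ m‖ < δ ^ m) :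
    ‖t‖ < δ := by
  rw [norm_pow] at h
  exact lt_of_pow_lt_pow_left₀ m hδ.le h

theorem IsCentredChart.eventually_norm_fst_lt (he : IsCentredChart e P) {δ : ℝ} (hδ : 0 < δ) :
    ∀ᶠ Q in 𝓝 P, ‖(e Q).1‖ < δ := by
  have h1 : Tendsto (fun Q => ‖(e Q).1‖) (𝓝 P) (𝓝 0) := by
    have : Tendsto (fun p : ℂ × ℂ => ‖p.1‖) (𝓝 0) (𝓝 0) := by
      have : Continuous fun p : ℂ × ℂ => ‖p.1‖ := by fun_prop
      simpa using this.tendsto 0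
    exact this.comp he.tendsto
  exact h1.eventually (gt_mem_nhds hδ)

theorem IsParamGerm.eventually_symm_mem {g : ℂ → ℂ × ℂ} (h : IsParamGerm C P e g) :
    ∀ᶠ t in 𝓝 0, e.symm (g t) ∈ C := by
  have h1 : {p | e.symm p ∈ C} ∈ map e (𝓝[C] P) := by
    refine mem_map.2 ?_
    filter_upwards [self_mem_nhdsWithin,
      mem_nhdsWithin_of_mem_nhds (e.open_source.mem_nhds h.centred.mem_source)] with Q h1 h2
    simpa [e.left_inv h2] using h1
  rw [h.map_eq] at h1
  exact h1

theorem IsParametrization.isPuiseuxGerm {m : ℕ} {c : ℕ → ℂ} {ε : ℝ}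
    (h : IsParametrization C P e m c ε) :
    ∃ f, (∀ᶠ t in 𝓝 (0 : ℂ), HasSum (fun k => c k * t ^ k) (f t)) ∧ IsPuiseuxGerm C P e m f := by
  set f : ℂ → ℂ := fun t => ∑' k, c k * t ^ k with hf
  have hsum : ∀ t : ℂ, ‖t‖ < ε → HasSum (fun k => c k * t ^ k) (f t) := fun t ht =>
    (h.summable t ht).hasSum
  have hball : ∀ᶠ t in 𝓝 (0 : ℂ), ‖t‖ < ε := by
    filter_upwards [Metric.ball_mem_nhds (0 : ℂ) h.eps_pos] with t ht
    simpa using ht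
  have hev : ∀ᶠ t in 𝓝 (0 : ℂ), HasSum (fun k => c k * t ^ k) (f t) := by
    filter_upwards [hball] with t ht using hsum t ht
  have he : IsCentredChart e P := ⟨h.chart, h.mem_source, h.centred⟩
  have hfm : f =O[𝓝 0] fun t => t ^ m := (isBigO_pow_iff_coeff_eq_zero hev m).2 h.coeff_eq_zero
  have hg := tendsto_pow_prodMk h.m_pos hfm
  refine ⟨f, hev, ⟨he, ?_, le_antisymm ?_ ?_⟩, h.m_pos, hfm⟩
  · exact (analyticAt_id.pow m).prod (hasFPowerSeriesAt_ofScalars hev).analyticAt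
  · intro s hs
    obtain ⟨δ, hδ, hs⟩ := Metric.mem_nhds_iff.1 (mem_map.1 hs)
    refine mem_map.2 (eventually_nhdsWithin_iff.2 ?_)
    filter_upwards [h.germ, he.eventually_norm_fst_lt (pow_pos hδ m)] with Q h1 h2 hQ
    obtain ⟨t, ht, h3, h4⟩ := h1.1 hQ
    have h5 : e Q = (t ^ m, f t) := Prod.ext h3 (h4.unique (hsum t ht))
    rw [h3] at h2
    have h6 : t ∈ Metric.ball (0 : ℂ) δ := by simpa using norm_lt_of_norm_pow_lt hδ h2
    show e Q ∈ s
    rw [h5]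
    exact hs h6
  · intro s hs
    have h1 : ∀ᶠ Q in 𝓝 P, Q ∈ C → e Q ∈ s := eventually_nhdsWithin_iff.1 (mem_map.1 hs)
    have h2 := he.tendsto_symm.comp hg
    refine mem_map.2 ?_
    filter_upwards [h2.eventually h1, h2.eventually h.germ, hball,
      hg.eventually (e.open_target.mem_nhds he.zero_mem_target)] with t h3 h4 h5 h6
    have h7 : e (e.symm (t ^ m, f t)) = (t ^ m, f t) := e.right_inv h6
    simp only [Function.comp_apply, h7] at h3 h4
    exact h3 (h4.2 ⟨t, h5, rfl, hsum t h5⟩)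

theorem IsPuiseuxGerm.isParametrization {m : ℕ} {f : ℂ → ℂ} (h : IsPuiseuxGerm C P e m f) :
    ∃ (c : ℕ → ℂ) (ε : ℝ), (∀ᶠ t in 𝓝 (0 : ℂ), HasSum (fun k => c k * t ^ k) (f t)) ∧
      IsParametrization C P e m c ε := by
  obtain ⟨c, ε, hε, hsum⟩ := eventually_exists_hasSum h.analyticAt
  have he := h.germ.centred
  have hev : ∀ᶠ t in 𝓝 (0 : ℂ), HasSum (fun k => c k * t ^ k) (f t) := by
    filter_upwards [Metric.ball_mem_nhds (0 : ℂ) hε] with t ht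
    exact hsum t (by simpa using ht)
  obtain ⟨δ, hδ, hmem⟩ := Metric.eventually_nhds_iff.1 h.germ.eventually_symm_mem
  refine ⟨c, ε, hev, he.chart, he.mem_source, he.centred, h.m_pos,
    (isBigO_pow_iff_coeff_eq_zero hev m).1 h.isBigO, hε, fun t ht => (hsum t ht).summable, ?_⟩
  have h1 : (fun t => (t ^ m, f t)) '' Metric.ball 0 ε ∈ map e (𝓝[C] P) := by
    rw [h.germ.map_eq]
    exact image_mem_map (Metric.ball_mem_nhds _ hε)
  have h2 : ∀ᶠ Q in 𝓝 P, Q ∈ C → e Q ∈ (fun t => (t ^ m, f t)) '' Metric.ball 0 ε :=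
    eventually_nhdsWithin_iff.1 (mem_map.1 h1)
  filter_upwards [h2, he.eventually_norm_fst_lt (pow_pos hδ m),
    e.open_source.mem_nhds he.mem_source] with Q h3 h4 h5
  constructor
  · intro hQ
    obtain ⟨t, ht, h6⟩ := h3 hQ
    have ht' : ‖t‖ < ε := by simpa using ht
    rw [← h6]
    exact ⟨t, ht', rfl, hsum t ht'⟩
  · rintro ⟨t, ht, h6, h7⟩
    have h8 : e Q = (t ^ m, f t) := Prod.ext h6 (h7.unique (hsum t ht))
    rw [h6] at h4
    have := @hmem t (by simpa using norm_lt_of_norm_pow_lt hδ h4)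
    rwa [← h8, e.left_inv h5] at this

/-- The Puiseux characteristic in terms of symmetries of a parametrization. -/
theorem hasPuiseuxChar_iff {m g : ℕ} {β : ℕ → ℕ} :
    HasPuiseuxChar C P m g β ↔ ∃ e f, IsPuiseuxGerm C P e m f ∧
      (∀ j, 1 ≤ j → j ≤ g → IsCharExp f (gcdSeq m β j) (β j)) ∧ gcdSeq m β (g + 1) = 1 := by
  constructor
  · rintro ⟨e, c, ε, h1, h2, h3⟩
    obtain ⟨f, hev, hf⟩ := h1.isPuiseuxGerm
    exact ⟨e, f, hf, fun j h4 h5 =>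
      (isCharExp_iff_isLeast hev (gcdSeq_ne_zero h1.m_pos β j) _).2 (h2 j h4 h5), h3⟩
  · rintro ⟨e, f, h1, h2, h3⟩
    obtain ⟨c, ε, hev, hf⟩ := h1.isParametrization
    exact ⟨e, c, ε, hf, fun j h4 h5 =>
      (isCharExp_iff_isLeast hev (gcdSeq_ne_zero h1.m_pos β j) _).1 (h2 j h4 h5), h3⟩

theorem IsCharExp.dvd_of_symmetricMod {f : ℂ → ℂ} (hf : AnalyticAt ℂ f 0) {d d' b : ℕ}
    (hd : d ≠ 0) (hd' : d' ≠ 0) (h : IsCharExp f d b) (h' : SymmetricMod f d' (b + 1)) :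
    d' ∣ b := by
  obtain ⟨c, ε, hε, hsum⟩ := eventually_exists_hasSum hf
  have hev : ∀ᶠ t in 𝓝 (0 : ℂ), HasSum (fun k => c k * t ^ k) (f t) := by
    filter_upwards [Metric.ball_mem_nhds (0 : ℂ) hε] with t ht
    exact hsum t (by simpa using ht)
  exact (symmetricMod_iff_coeff hev hd' _).1 h' b b.lt_succ_self
    ((isCharExp_iff_isLeast hev hd b).1 h).1.1

theorem IsCharExp.not_dvd {f : ℂ → ℂ} (hf : AnalyticAt ℂ f 0) {d b : ℕ}
    (hd : d ≠ 0) (h : IsCharExp f d b) : ¬ d ∣ b := by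
  obtain ⟨c, ε, hε, hsum⟩ := eventually_exists_hasSum hf
  have hev : ∀ᶠ t in 𝓝 (0 : ℂ), HasSum (fun k => c k * t ^ k) (f t) := by
    filter_upwards [Metric.ball_mem_nhds (0 : ℂ) hε] with t ht
    exact hsum t (by simpa using ht)
  exact ((isCharExp_iff_isLeast hev hd b).1 h).1.2

/-- A full symmetry of order `d` makes `d` divide every exponent that occurs, in particular each
β_j, hence every m_j up to the last one, which is 1. -/
theorem isPrimitiveSeries_of_isCharExp {m g : ℕ} {β : ℕ → ℕ} {f : ℂ → ℂ} (hm : 0 < m)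
    (hf : AnalyticAt ℂ f 0) (h : ∀ j, 1 ≤ j → j ≤ g → IsCharExp f (gcdSeq m β j) (β j))
    (hg : gcdSeq m β (g + 1) = 1) : IsPrimitiveSeries f m := by
  intro d hd hs
  have hd0 : d ≠ 0 := (Nat.pos_of_dvd_of_pos hd hm).ne'
  have key : ∀ j, j ≤ g → d ∣ gcdSeq m β (j + 1) := by
    intro j
    induction j with
    | zero => exact fun _ => hd
    | succ j ih =>
      intro hj
      rw [gcdSeq_succ m β (by omega)]
      exact Nat.dvd_gcd (ih (by omega)) ((h (j + 1) (by omega) hj).dvd_of_symmetricMod hf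
        (gcdSeq_ne_zero hm β _) hd0 (hs _))
  have := key g le_rfl
  rw [hg] at this
  exact Nat.dvd_one.1 this

/-- The number of characteristic exponents is an invariant of the germ. -/
theorem HasPuiseuxChar.length_unique {m m' g g' : ℕ} {β β' : ℕ → ℕ}
    (h : HasPuiseuxChar C P m g β) (h' : HasPuiseuxChar C P m' g' β') : g = g' := by
  wlog hle : g ≤ g' generalizing m m' g g' β β'
  · exact (this h' h (by omega)).symm
  obtain ⟨e, f, h1, h2, h3⟩ := hasPuiseuxChar_iff.1 h
  obtain ⟨e', f', h1', h2', h3'⟩ := hasPuiseuxChar_iff.1 h'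
  obtain ⟨rfl, hs⟩ := h1.unique h1' (isPrimitiveSeries_of_isCharExp h1.m_pos h1.analyticAt h2 h3)
    (isPrimitiveSeries_of_isCharExp h1'.m_pos h1'.analyticAt h2' h3')
  have key : ∀ j, j ≤ g → gcdSeq m β (j + 1) = gcdSeq m β' (j + 1) := by
    intro j
    induction j with
    | zero => exact fun _ => rfl
    | succ j ih =>
      intro hj
      have h4 := ih (by omega)
      have h5 := h2 (j + 1) (by omega) hj
      have h6 := h2' (j + 1) (by omega) (by omega)
      rw [← h4, IsCharExp, ← hs _ (gcdSeq_dvd m β _), ← hs _ (gcdSeq_dvd m β _)] at h6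
      rw [gcdSeq_succ m β (by omega), gcdSeq_succ m β' (by omega), ← h4, h5.unique h6]
  -- A further exponent of the longer characteristic would break a symmetry for `d = 1`, which is
  -- trivial.
  by_contra hne
  have h4 := h2' (g + 1) (by omega) (by omega)
  rw [← key g le_rfl, h3] at h4
  exact h4.2 (symmetricMod_one _ _)

theorem IsSmoothAt.hasPuiseuxChar (h : IsSmoothAt C P) (β : ℕ → ℕ) :
    HasPuiseuxChar C P 1 0 β := by
  obtain ⟨e, h1, h2, h3, h4⟩ := h
  have he : IsCentredChart e P := ⟨h1, h2, h3⟩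
  have h0 : (fun _ : ℂ => (0 : ℂ)) =O[𝓝 0] fun t : ℂ => t ^ 1 := isBigO_zero _ _
  have hg := tendsto_pow_prodMk one_pos h0
  refine hasPuiseuxChar_iff.2 ⟨e, fun _ => 0, ⟨⟨he, ?_, le_antisymm ?_ ?_⟩, one_pos, h0⟩,
    fun j h5 h6 => absurd h6 (by omega), rfl⟩
  · exact (analyticAt_id.pow 1).prod analyticAt_const
  · intro s hs
    have h5 : Tendsto (fun Q => (e Q).1) (𝓝 P) (𝓝 0) :=
      (continuous_fst.tendsto (0 : ℂ × ℂ)).comp he.tendsto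
    refine mem_map.2 (eventually_nhdsWithin_iff.2 ?_)
    filter_upwards [h5.eventually (mem_map.1 hs), e.open_source.mem_nhds h2] with Q h6 h7 hQ
    have h8 : e Q = ((e Q).1 ^ 1, 0) := Prod.ext (pow_one _).symm ((h4 Q h7).1 hQ)
    show e Q ∈ s
    rw [h8]
    exact h6
  · intro s hs
    have h5 : ∀ᶠ Q in 𝓝 P, Q ∈ C → e Q ∈ s := eventually_nhdsWithin_iff.1 (mem_map.1 hs)
    refine mem_map.2 ?_
    filter_upwards [(he.tendsto_symm.comp hg).eventually h5,
      hg.eventually (e.open_target.mem_nhds he.zero_mem_target)] with t h6 h7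
    simp only [Function.comp_apply, e.right_inv h7] at h6
    exact h6 ((h4 _ (e.map_target h7)).2 (by rw [e.right_inv h7]))

end Parametrization

/-! ### Charts modified by global biholomorphisms of the model. -/

section Charts

variable {X : Type*} [TopologicalSpace X] [ChartedSpace (ℂ × ℂ) X]
  [IsManifold 𝓘(ℂ, ℂ × ℂ) ω X]

theorem transHomeomorph_mem_maximalAtlas {e : OpenPartialHomeomorph X (ℂ × ℂ)}
    (he : e ∈ IsManifold.maximalAtlas 𝓘(ℂ, ℂ × ℂ) ω X) (h : (ℂ × ℂ) ≃ₜ (ℂ × ℂ))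
    (h1 : ContDiff ℂ ω h) (h2 : ContDiff ℂ ω h.symm) :
    e.transHomeomorph h ∈ IsManifold.maximalAtlas 𝓘(ℂ, ℂ × ℂ) ω X := by
  refine OpenPartialHomeomorph.mem_maximalAtlas_of_contMDiffOn _ ?_ ?_
  · exact (contMDiff_iff_contDiff.2 h1).comp_contMDiffOn (contMDiffOn_of_mem_maximalAtlas he)
  · exact (contMDiffOn_symm_of_mem_maximalAtlas he).comp
      (contMDiff_iff_contDiff.2 h2).contMDiffOn fun _ hp => hp

/-- The two coordinates of a chart interchanged. -/
noncomputable abbrev swapChart (e : OpenPartialHomeomorph X (ℂ × ℂ)) : OpenPartialHomeomorph X (ℂ × ℂ) :=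
  e.transHomeomorph (Homeomorph.prodComm ℂ ℂ)

theorem swapChart_mem_maximalAtlas {e : OpenPartialHomeomorph X (ℂ × ℂ)}
    (he : e ∈ IsManifold.maximalAtlas 𝓘(ℂ, ℂ × ℂ) ω X) :
    swapChart e ∈ IsManifold.maximalAtlas 𝓘(ℂ, ℂ × ℂ) ω X :=
  transHomeomorph_mem_maximalAtlas he _ (contDiff_snd.prodMk contDiff_fst)
    (contDiff_snd.prodMk contDiff_fst)

theorem IsCentredChart.swap {e : OpenPartialHomeomorph X (ℂ × ℂ)} {P : X}
    (he : IsCentredChart e P) : IsCentredChart (swapChart e) P := by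
  refine ⟨swapChart_mem_maximalAtlas he.chart, he.mem_source, ?_⟩
  show (e P).swap = 0
  rw [he.centred]
  rfl

end Charts

/-! ### Affine charts of the blowing up and the strict transform of a germ. -/

section Blowup

variable {X Y : Type*} [TopologicalSpace X] [ChartedSpace (ℂ × ℂ) X]
  [TopologicalSpace Y] [ChartedSpace (ℂ × ℂ) Y]

/-- The two standard affine charts `f₁`, `f₂` of a blowing up over the chart `e`. -/
structure IsBlowupCharts (π : Y → X) (P : X) (e : OpenPartialHomeomorph X (ℂ × ℂ))
    (f₁ f₂ : OpenPartialHomeomorph Y (ℂ × ℂ)) : Prop where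
  centred : IsCentredChart e P
  chart₁ : f₁ ∈ IsManifold.maximalAtlas 𝓘(ℂ, ℂ × ℂ) ω Y
  chart₂ : f₂ ∈ IsManifold.maximalAtlas 𝓘(ℂ, ℂ × ℂ) ω Y
  preimage : π ⁻¹' e.source = f₁.source ∪ f₂.source
  target₁ : f₁.target = {w | (w.1, w.1 * w.2) ∈ e.target}
  target₂ : f₂.target = {w | (w.1 * w.2, w.2) ∈ e.target}
  apply₁ : ∀ Q ∈ f₁.source, e (π Q) = ((f₁ Q).1, (f₁ Q).1 * (f₁ Q).2)
  apply₂ : ∀ Q ∈ f₂.source, e (π Q) = ((f₂ Q).1 * (f₂ Q).2, (f₂ Q).2)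
  mem_iff : ∀ Q ∈ f₁.source, (Q ∈ f₂.source ↔ (f₁ Q).2 ≠ 0)
  glue : ∀ Q ∈ f₁.source, Q ∈ f₂.source → f₂ Q = ((f₁ Q).2⁻¹, (f₁ Q).1 * (f₁ Q).2)

theorem IsBlowupAt.exists_charts {π : Y → X} {P : X} (h : IsBlowupAt π P) :
    ∃ e f₁ f₂, IsBlowupCharts π P e f₁ f₂ := by
  obtain ⟨e, he, f₁, h1, f₂, h2, h3, h4, h5, h6, h7, h8, h9, h10, h11⟩ := h.charts
  exact ⟨e, f₁, f₂, ⟨he, h3, h4⟩, h1, h2, h5, h6, h7, h8, h9, h10, h11⟩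

variable {π : Y → X} {P : X} {e : OpenPartialHomeomorph X (ℂ × ℂ)}
  {f₁ f₂ : OpenPartialHomeomorph Y (ℂ × ℂ)}

theorem IsBlowupCharts.mem_iff₂ (h : IsBlowupCharts π P e f₁ f₂) {Q : Y} (hQ : Q ∈ f₂.source) :
    Q ∈ f₁.source ↔ (f₂ Q).1 ≠ 0 := by
  constructor
  · intro hQ₁
    rw [h.glue Q hQ₁ hQ]
    exact inv_ne_zero ((h.mem_iff Q hQ₁).1 hQ)
  · intro hu
    -- The coordinates that `Q` must have in the first chart; injectivity of `f₂` identifies the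
    -- point they define with `Q`.
    set w : ℂ × ℂ := ((f₂ Q).1 * (f₂ Q).2, (f₂ Q).1⁻¹) with hw
    have h1 : f₂ Q ∈ f₂.target := f₂.map_source hQ
    have hmul : (f₂ Q).1 * (f₂ Q).2 * (f₂ Q).1⁻¹ = (f₂ Q).2 := by field_simp
    have hwt : w ∈ f₁.target := by
      rw [h.target₂] at h1
      rw [h.target₁]
      simpa [hw, hmul] using h1
    have h2 := f₁.map_target hwt
    have h3 : f₁ (f₁.symm w) = w := f₁.right_inv hwt
    have h4 : f₁.symm w ∈ f₂.source := (h.mem_iff _ h2).2 (by rw [h3]; exact inv_ne_zero hu)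
    have h5 : f₂ (f₁.symm w) = f₂ Q := by
      rw [h.glue _ h2 h4, h3]
      simp [hw, hmul]
    rwa [f₂.injOn h4 hQ h5] at h2

theorem IsBlowupCharts.swap [IsManifold 𝓘(ℂ, ℂ × ℂ) ω X] [IsManifold 𝓘(ℂ, ℂ × ℂ) ω Y]
    (h : IsBlowupCharts π P e f₁ f₂) :
    IsBlowupCharts π P (swapChart e) (swapChart f₂) (swapChart f₁) where
  centred := h.centred.swap
  chart₁ := swapChart_mem_maximalAtlas h.chart₂
  chart₂ := swapChart_mem_maximalAtlas h.chart₁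
  preimage := h.preimage.trans (Set.union_comm _ _)
  target₁ := by
    ext w
    show w.swap ∈ f₂.target ↔ (w.1 * w.2, w.1) ∈ e.target
    rw [h.target₂]
    simp [mul_comm]
  target₂ := by
    ext w
    show w.swap ∈ f₁.target ↔ (w.2, w.1 * w.2) ∈ e.target
    rw [h.target₁]
    simp [mul_comm]
  apply₁ Q hQ := by
    show (e (π Q)).swap = ((f₂ Q).2, (f₂ Q).2 * (f₂ Q).1)
    rw [h.apply₂ Q hQ, mul_comm]
    rfl
  apply₂ Q hQ := by
    show (e (π Q)).swap = ((f₁ Q).2 * (f₁ Q).1, (f₁ Q).1)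
    rw [h.apply₁ Q hQ, mul_comm]
    rfl
  mem_iff Q hQ := h.mem_iff₂ hQ
  glue Q hQ hQ' := by
    show (f₁ Q).swap = ((f₂ Q).1⁻¹, (f₂ Q).2 * (f₂ Q).1)
    have h1 : (f₁ Q).2 ≠ 0 := (h.mem_iff Q hQ').1 hQ
    rw [h.glue Q hQ' hQ]
    ext
    · simp
    · simp only [Prod.snd_swap]
      field_simp

section StrictTransform

variable {C : Set X} {m : ℕ} {f k : ℂ → ℂ}

theorem IsBlowupCharts.eventually_lift (h : IsBlowupCharts π P e f₁ f₂) (hπ : Continuous π)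
    (hf : IsPuiseuxGerm C P e m f) (hk : ∀ᶠ t in 𝓝 0, f t = t ^ m * k t) {Q : Y} (hQ : π Q = P)
    {U : Set ℂ} (hU : U ∈ 𝓝 (0 : ℂ)) :
    ∀ᶠ R in 𝓝 Q, R ∈ π ⁻¹' (C \ {P}) →
      ∃ t ∈ U, t ≠ 0 ∧ e (π R) = (t ^ m, t ^ m * k t) := by
  have h1 : (fun t => (t ^ m, f t)) '' (U ∩ {t | f t = t ^ m * k t}) ∈ map e (𝓝[C] P) := by
    rw [hf.germ.map_eq]
    exact image_mem_map (inter_mem hU hk)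
  have h2 := (eventually_nhdsWithin_iff.1 (mem_map.1 h1)).and
    (e.open_source.mem_nhds h.centred.mem_source)
  rw [← hQ] at h2
  filter_upwards [hπ.continuousAt.eventually h2] with R ⟨h3, h4⟩ hR
  obtain ⟨t, ⟨htU, ht⟩, h5⟩ := h3 hR.1
  have h6 : e (π R) = (t ^ m, t ^ m * k t) := h5.symm.trans (Prod.ext rfl ht)
  refine ⟨t, htU, ?_, h6⟩
  rintro rfl
  apply hR.2
  refine e.injOn h4 h.centred.mem_source ?_
  rw [h.centred.centred, h6, zero_pow hf.m_pos.ne', zero_mul]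
  rfl

/-- Outside the first chart the first coordinate of `f₂` would vanish at `Q`, yet on the lifted
curve it is the inverse of the bounded function `k`. So the strict transform has at most one point
over `P`, at slope `k 0`. -/
theorem IsBlowupCharts.mem_source_of_mem_strictTransform (h : IsBlowupCharts π P e f₁ f₂)
    (hπ : Continuous π) (hf : IsPuiseuxGerm C P e m f) (hk : ∀ᶠ t in 𝓝 0, f t = t ^ m * k t)
    (hka : AnalyticAt ℂ k 0) {Q : Y} (hQ : π Q = P) (hQC : Q ∈ strictTransform π P C) :
    Q ∈ f₁.source ∧ f₁ Q = (0, k 0) := by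
  have hne : NeBot (𝓝[π ⁻¹' (C \ {P})] Q) := mem_closure_iff_nhdsWithin_neBot.1 hQC
  have hlift : ∀ {U : Set ℂ}, U ∈ 𝓝 (0 : ℂ) → ∀ᶠ R in 𝓝[π ⁻¹' (C \ {P})] Q,
      ∃ t ∈ U, t ≠ 0 ∧ e (π R) = (t ^ m, t ^ m * k t) := fun hU =>
    eventually_nhdsWithin_iff.2 (h.eventually_lift hπ hf hk hQ hU)
  have hsrc : Q ∈ f₁.source := by
    by_contra hQ₁
    have hQ₂ : Q ∈ f₂.source := by
      have : Q ∈ π ⁻¹' e.source := by simp [hQ, h.centred.mem_source]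
      rw [h.preimage] at this
      exact this.resolve_left hQ₁
    have h0 : (f₂ Q).1 = 0 := by
      by_contra hu
      exact hQ₁ ((h.mem_iff₂ hQ₂).2 hu)
    have h1 : Tendsto (fun R => ‖(f₂ R).1‖) (𝓝 Q) (𝓝 0) := by
      have := (continuous_fst.norm.tendsto (f₂ Q)).comp (f₂.continuousAt hQ₂).tendsto
      rwa [h0, norm_zero] at this
    have hU : {t | ‖k t‖ < ‖k 0‖ + 1} ∈ 𝓝 (0 : ℂ) :=
      hka.continuousAt.norm.eventually (gt_mem_nhds (lt_add_one _))
    have hpos : 0 < (‖k 0‖ + 1)⁻¹ := by positivity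
    obtain ⟨R, ⟨t, htU, ht0, h2⟩, h3, h4⟩ := ((hlift hU).and
      (((h1.eventually (gt_mem_nhds hpos)).and (f₂.open_source.mem_nhds hQ₂)).filter_mono
        nhdsWithin_le_nhds)).exists
    rw [h.apply₂ R h4] at h2
    obtain ⟨h5, h6⟩ := Prod.mk.inj h2
    rw [h6] at h5
    have htm : t ^ m ≠ 0 := pow_ne_zero _ ht0
    have h7 : (f₂ R).1 * k t = 1 := by
      refine mul_left_cancel₀ htm ?_
      linear_combination h5
    have h8 : ‖(f₂ R).1‖ * ‖k t‖ = 1 := by rw [← norm_mul, h7, norm_one]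
    have h9 : ‖k t‖ < ‖k 0‖ + 1 := htU
    have h10 : ‖(f₂ R).1‖ * ‖k t‖ < (‖k 0‖ + 1)⁻¹ * (‖k 0‖ + 1) :=
      mul_lt_mul'' h3 h9 (norm_nonneg _) (norm_nonneg _)
    rw [h8, inv_mul_cancel₀ (by positivity)] at h10
    exact lt_irrefl _ h10
  refine ⟨hsrc, Prod.ext ?_ ?_⟩
  · have := h.apply₁ Q hsrc
    rw [hQ, h.centred.centred] at this
    exact (congrArg Prod.fst this).symm
  · have h1 : Tendsto (fun R => (f₁ R).2) (𝓝[π ⁻¹' (C \ {P})] Q) (𝓝 (f₁ Q).2) :=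
      ((continuous_snd.tendsto (f₁ Q)).comp (f₁.continuousAt hsrc).tendsto).mono_left
        nhdsWithin_le_nhds
    refine tendsto_nhds_unique h1 ?_
    intro V hV
    refine mem_map.2 ?_
    filter_upwards [hlift (hka.continuousAt.preimage_mem_nhds hV),
      mem_nhdsWithin_of_mem_nhds (f₁.open_source.mem_nhds hsrc)] with R ⟨t, htV, ht0, h2⟩ h3
    rw [h.apply₁ R h3] at h2
    obtain ⟨h5, h6⟩ := Prod.mk.inj h2
    rw [h5] at h6
    have h7 : (f₁ R).2 = k t := mul_left_cancel₀ (pow_ne_zero _ ht0) h6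
    show (f₁ R).2 ∈ V
    rw [h7]
    exact htV

/-- The strict transform of a parametrized germ, in the first affine chart. -/
theorem IsBlowupCharts.map_strictTransform (h : IsBlowupCharts π P e f₁ f₂)
    (hπ : Continuous π) (hC : IsClosed C) (hf : IsPuiseuxGerm C P e m f)
    (hk : ∀ᶠ t in 𝓝 0, f t = t ^ m * k t)
    (hka : AnalyticAt ℂ k 0) {Q : Y} (hQ : π Q = P) (hQC : Q ∈ strictTransform π P C) :
    map f₁ (𝓝[strictTransform π P C] Q) = map (fun t => (t ^ m, k t)) (𝓝 0) := by
  obtain ⟨hsrc, hf₁Q⟩ := h.mem_source_of_mem_strictTransform hπ hf hk hka hQ hQC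
  have hsub : strictTransform π P C ⊆ π ⁻¹' C :=
    closure_minimal (Set.preimage_mono Set.sdiff_subset) (hC.preimage hπ)
  refine le_antisymm ?_ ?_
  · intro s hs
    refine mem_map.2 (eventually_nhdsWithin_iff.2 ?_)
    have hs' : (fun t => (t ^ m, k t)) ⁻¹' s ∈ 𝓝 (0 : ℂ) := hs
    filter_upwards [h.eventually_lift hπ hf hk hQ hs', f₁.open_source.mem_nhds hsrc]
      with R h1 h2 hR
    show f₁ R ∈ s
    -- A point of the strict transform over `P` has coordinates `(0, k 0)`, the value at parameter
    -- 0; any other point is lifted from `C`.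
    by_cases hRP : π R = P
    · rw [(h.mem_source_of_mem_strictTransform hπ hf hk hka hRP hR).2]
      have := mem_of_mem_nhds hs'
      simpa [hf.m_pos.ne'] using this
    · obtain ⟨t, hts, ht0, h3⟩ := h1 ⟨hsub hR, hRP⟩
      rw [h.apply₁ R h2] at h3
      obtain ⟨h5, h6⟩ := Prod.mk.inj h3
      rw [h5] at h6
      have h7 : (f₁ R).2 = k t := mul_left_cancel₀ (pow_ne_zero _ ht0) h6
      have h8 : f₁ R = (t ^ m, k t) := Prod.ext h5 h7
      rw [h8]
      exact hts
  · intro s hs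
    have h1 : ∀ᶠ R in 𝓝 Q, R ∈ strictTransform π P C → f₁ R ∈ s :=
      eventually_nhdsWithin_iff.1 (mem_map.1 hs)
    have hg : Tendsto (fun t => (t ^ m, k t)) (𝓝 0) (𝓝 (f₁ Q)) := by
      rw [hf₁Q]
      have h2 : Tendsto (fun t : ℂ => t ^ m) (𝓝 0) (𝓝 0) := (map_pow_nhds_zero hf.m_pos).le
      exact h2.prodMk_nhds hka.continuousAt.tendsto
    have hlift : Tendsto (fun t => f₁.symm (t ^ m, k t)) (𝓝 0) (𝓝 Q) :=
      (f₁.tendsto_symm hsrc).comp hg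
    have hQe : π Q ∈ e.source := by rw [hQ]; exact h.centred.mem_source
    refine mem_map.2 ?_
    filter_upwards [hlift.eventually h1, hg.eventually (f₁.open_target.mem_nhds
      (f₁.map_source hsrc)), hf.germ.eventually_symm_mem, hk,
      hlift.eventually (hπ.continuousAt.eventually (e.open_source.mem_nhds hQe))]
      with t h2 h3 h4 h5 h6
    have h7 := f₁.right_inv h3
    rw [h7] at h2
    refine h2 ?_
    rcases eq_or_ne t 0 with rfl | ht
    · rw [zero_pow hf.m_pos.ne', ← hf₁Q, f₁.left_inv hsrc]
      exact hQC
    · have h8 := h.apply₁ _ (f₁.map_target h3)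
      rw [h7, ← h5] at h8
      refine subset_closure ⟨?_, fun hP => ?_⟩
      · rw [← h8, e.left_inv h6] at h4
        exact h4
      · have hP' : π (f₁.symm (t ^ m, k t)) = P := hP
        rw [hP', h.centred.centred] at h8
        exact pow_ne_zero m ht (congrArg Prod.fst h8).symm

theorem IsBlowupCharts.isParamGerm_strictTransform [IsManifold 𝓘(ℂ, ℂ × ℂ) ω Y]
    (h : IsBlowupCharts π P e f₁ f₂)
    (hπ : Continuous π) (hC : IsClosed C) (hf : IsPuiseuxGerm C P e m f)
    (hk : ∀ᶠ t in 𝓝 0, f t = t ^ m * k t)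
    (hka : AnalyticAt ℂ k 0) {Q : Y} (hQ : π Q = P) (hQC : Q ∈ strictTransform π P C) :
    ∃ e', IsParamGerm (strictTransform π P C) Q e' fun t => (t ^ m, k t - k 0) := by
  obtain ⟨hsrc, hf₁Q⟩ := h.mem_source_of_mem_strictTransform hπ hf hk hka hQ hQC
  let τ : (ℂ × ℂ) ≃ₜ (ℂ × ℂ) := Homeomorph.subRight (0, k 0)
  refine ⟨f₁.transHomeomorph τ, ⟨transHomeomorph_mem_maximalAtlas h.chart₁ τ
    (contDiff_id.sub contDiff_const) (contDiff_id.add contDiff_const), hsrc, ?_⟩, ?_, ?_⟩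
  · show f₁ Q - (0, k 0) = 0
    rw [hf₁Q, sub_self]
  · exact (analyticAt_id.pow m).prod (hka.sub analyticAt_const)
  · have h1 := congrArg (map τ) (h.map_strictTransform hπ hC hf hk hka hQ hQC)
    rw [Filter.map_map, Filter.map_map] at h1
    refine h1.trans (map_congr (Eventually.of_forall fun t => ?_))
    show (t ^ m, k t) - (0, k 0) = _
    simp

end StrictTransform

end Blowup

/-! ### Comparing symmetries with orders of vanishing. -/

section SymmetryLemmas

theorem SymmetricMod.of_dvd {f : ℂ → ℂ} {d d' b : ℕ} (h : SymmetricMod f d b) (hd : d' ∣ d) :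
    SymmetricMod f d' b := by
  rintro ζ hζ
  obtain ⟨q, rfl⟩ := hd
  exact h ζ (by rw [pow_mul, hζ, one_pow])

theorem IsCharExp.le_of_dvd {f : ℂ → ℂ} {d d' b b' : ℕ} (h : IsCharExp f d b)
    (h' : IsCharExp f d' b') (hd : d' ∣ d) : b ≤ b' := by
  by_contra! hlt
  exact h'.2 ((h.1.mono hlt).of_dvd hd)

/-- The exponents below `b` are multiples of `d`, and 0 is excluded since `f` vanishes at the
origin; hence none is below `n`. -/
theorem SymmetricMod.isBigO_pow {f : ℂ → ℂ} (hf : AnalyticAt ℂ f 0)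
    (h1 : f =O[𝓝 0] fun t => t ^ 1) {d b n : ℕ} (hd : d ≠ 0) (h : SymmetricMod f d b)
    (hnd : n ≤ d) (hnb : n ≤ b) : f =O[𝓝 0] fun t => t ^ n := by
  obtain ⟨c, ε, hε, hsum⟩ := eventually_exists_hasSum hf
  have hev : ∀ᶠ t in 𝓝 (0 : ℂ), HasSum (fun k => c k * t ^ k) (f t) := by
    filter_upwards [Metric.ball_mem_nhds (0 : ℂ) hε] with t ht
    exact hsum t (by simpa using ht)
  refine (isBigO_pow_iff_coeff_eq_zero hev n).2 fun k hk => ?_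
  by_contra hc
  have h2 := (symmetricMod_iff_coeff hev hd b).1 h k (by omega) hc
  have h3 : k = 0 := Nat.eq_zero_of_dvd_of_lt h2 (by omega)
  subst h3
  exact hc ((isBigO_pow_iff_coeff_eq_zero hev 1).1 h1 0 one_pos)

theorem isCharExp_of_exact_order {f : ℂ → ℂ} (hf : AnalyticAt ℂ f 0) {d m : ℕ} (hd : d ≠ 0)
    (hdm : ¬ d ∣ m) (h1 : f =O[𝓝 0] fun t => t ^ m) (h2 : ¬ f =O[𝓝 0] fun t => t ^ (m + 1)) :
    IsCharExp f d m := by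
  obtain ⟨c, ε, hε, hsum⟩ := eventually_exists_hasSum hf
  have hev : ∀ᶠ t in 𝓝 (0 : ℂ), HasSum (fun k => c k * t ^ k) (f t) := by
    filter_upwards [Metric.ball_mem_nhds (0 : ℂ) hε] with t ht
    exact hsum t (by simpa using ht)
  refine ⟨symmetricMod_of_isBigO h1 d, fun hs => h2 ?_⟩
  rw [isBigO_pow_iff_coeff_eq_zero hev] at h1 ⊢
  intro k hk
  rcases Nat.lt_succ_iff_lt_or_eq.1 hk with hk | rfl
  · exact h1 k hk
  · by_contra hc
    exact hdm ((symmetricMod_iff_coeff hev hd _).1 hs k k.lt_succ_self hc)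

end SymmetryLemmas

/-! ### Euclid's algorithm and the effect of each step on the gcd sequence. -/

section Arithmetic

/-- After the first division only the remainder matters; non-divisibility ensures that the first
quotient is not also the last. -/
theorem lastQuotient_congr {a a' b : ℕ} (h : a ≡ a' [MOD b]) (hb : ¬ b ∣ a) :
    lastQuotient a b = lastQuotient a' b := by
  cases b with
  | zero =>
    rw [Nat.modEq_zero_iff] at h
    rw [h]
  | succ b =>
    have h1 : a % (b + 1) = a' % (b + 1) := h
    rw [lastQuotient, lastQuotient, ← h1, if_neg (mt Nat.dvd_of_mod_eq_zero hb),
      if_neg (mt Nat.dvd_of_mod_eq_zero hb)]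

theorem lastQuotient_add_of_lt {m n : ℕ} (hn : 0 < n) (hnm : n < m) :
    lastQuotient (m + n) m = lastQuotient m n := by
  obtain ⟨b, rfl⟩ := Nat.exists_eq_succ_of_ne_zero (by omega : m ≠ 0)
  rw [lastQuotient]
  have h1 : (b.succ + n) % (b + 1) = n := by
    rw [Nat.succ_eq_add_one, Nat.add_mod_left, Nat.mod_eq_of_lt hnm]
  rw [h1, if_neg hn.ne']

theorem lastQuotient_of_dvd {m n : ℕ} (hn : 0 < n) (hnm : n ∣ m) :
    lastQuotient m n * n = m := by
  obtain ⟨b, rfl⟩ := Nat.exists_eq_succ_of_ne_zero hn.ne'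
  rw [lastQuotient, if_pos (Nat.mod_eq_zero_of_dvd hnm), Nat.div_mul_cancel hnm]

theorem gcd_congr_right {d b b' : ℕ} (h : b ≡ b' [MOD d]) : Nat.gcd d b = Nat.gcd d b' := by
  rw [Nat.gcd_comm d b, Nat.gcd_comm d b', h.gcd_eq]

theorem sub_modEq {d b m : ℕ} (hdm : d ∣ m) (hmb : m ≤ b) : b - m ≡ b [MOD d] := by
  obtain ⟨q, rfl⟩ := hdm
  obtain ⟨c, rfl⟩ := Nat.exists_eq_add_of_le hmb
  simp [Nat.ModEq]

theorem add_modEq {d b m : ℕ} (hdm : d ∣ m) : b + m ≡ b [MOD d] := by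
  obtain ⟨q, rfl⟩ := hdm
  simp [Nat.ModEq]

theorem gcdSeq_sub {m g : ℕ} {β : ℕ → ℕ} (hβ : ∀ j, 1 ≤ j → j ≤ g → m ≤ β j) {j : ℕ} (hj : 1 ≤ j)
    (hjg : j ≤ g + 1) : gcdSeq m (fun i => β i - m) j = gcdSeq m β j := by
  induction j, hj using Nat.le_induction with
  | base => rfl
  | succ j hj ih =>
    rw [gcdSeq_succ _ _ hj, gcdSeq_succ _ _ hj, ih (by omega)]
    exact gcd_congr_right (sub_modEq (gcdSeq_dvd m β j) (hβ j hj (by omega)))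

theorem sub_add_modEq_gcdSeq {m : ℕ} {β : ℕ → ℕ} {j : ℕ} (hj : 2 ≤ j) (hβ : β 1 ≤ β j) :
    β j - β 1 + m ≡ β j [MOD gcdSeq m β j] := by
  have h1 : gcdSeq m β j ∣ β 1 :=
    (gcdSeq_dvd_of_le m β (i := 2) (by omega) hj).trans (Nat.gcd_dvd_right _ _)
  exact (add_modEq (gcdSeq_dvd m β j)).trans (sub_modEq h1 hβ)

theorem gcdSeq_swap {m n g : ℕ} {β : ℕ → ℕ} (hn : β 1 = m + n)
    (hβ : ∀ j, 1 ≤ j → j ≤ g → β 1 ≤ β j) {j : ℕ} (hj : 2 ≤ j) (hjg : j ≤ g + 1) :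
    gcdSeq n (fun i => if i = 1 then m else β i - β 1 + m) j = gcdSeq m β j := by
  induction j, hj using Nat.le_induction with
  | base =>
    show Nat.gcd n m = Nat.gcd m (β 1)
    rw [hn, Nat.gcd_comm]
    simp
  | succ j hj ih =>
    rw [gcdSeq_succ _ _ (by omega), gcdSeq_succ _ _ (by omega), ih (by omega), if_neg (by omega)]
    exact gcd_congr_right (sub_add_modEq_gcdSeq hj (hβ j (by omega) (by omega)))

/-- When `n ∣ m`, the new multiplicity `n` already equals m_2, so the sequence is shifted by one;
the later exponents change only by multiples of m_j. -/
theorem gcdSeq_drop {m n g : ℕ} {β : ℕ → ℕ} (hn : β 1 = m + n) (hnm : n ∣ m)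
    (hβ : ∀ j, 1 ≤ j → j ≤ g → β 1 ≤ β j) {j : ℕ} (hj : 1 ≤ j) (hjg : j ≤ g) :
    gcdSeq n (fun i => β (i + 1) - β 1 + m) j = gcdSeq m β (j + 1) := by
  induction j, hj using Nat.le_induction with
  | base =>
    show n = Nat.gcd m (β 1)
    rw [hn]
    simp [Nat.gcd_eq_right hnm]
  | succ j hj ih =>
    rw [gcdSeq_succ _ _ (by omega), gcdSeq_succ _ _ (by omega), ih (by omega)]
    exact gcd_congr_right (sub_add_modEq_gcdSeq (by omega) (hβ (j + 1) (by omega) (by omega)))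

end Arithmetic

/-! ### One blowing up. -/

section BlowupStep

variable {X Y : Type*} [TopologicalSpace X] [ChartedSpace (ℂ × ℂ) X]
  [TopologicalSpace Y] [ChartedSpace (ℂ × ℂ) Y]
  {π : Y → X} {P : X} {C : Set X} {m : ℕ} {f : ℂ → ℂ}

theorem HasPuiseuxChar.le {g : ℕ} {β : ℕ → ℕ} (h : HasPuiseuxChar C P m g β) {i j : ℕ}
    (hi : 1 ≤ i) (hij : i ≤ j) (hj : j ≤ g) : β i ≤ β j := by
  obtain ⟨e, f, -, h2, -⟩ := hasPuiseuxChar_iff.1 h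
  exact (h2 i hi (hij.trans hj)).le_of_dvd (h2 j (hi.trans hij) hj) (gcdSeq_dvd_of_le m β hi hij)

theorem HasPuiseuxChar.not_dvd {g : ℕ} {β : ℕ → ℕ} (h : HasPuiseuxChar C P m g β) {j : ℕ}
    (hj : 1 ≤ j) (hjg : j ≤ g) : ¬ gcdSeq m β j ∣ β j := by
  obtain ⟨e, f, h1, h2, -⟩ := hasPuiseuxChar_iff.1 h
  exact (h2 j hj hjg).not_dvd h1.analyticAt (gcdSeq_ne_zero h1.m_pos β j)

theorem HasPuiseuxChar.lt {g : ℕ} {β : ℕ → ℕ} (h : HasPuiseuxChar C P m g β)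
    (hg : 1 ≤ g) : 0 < m ∧ m < β 1 := by
  have h3 : ¬ m ∣ β 1 := h.not_dvd le_rfl hg
  obtain ⟨e, f, h1, h2, -⟩ := hasPuiseuxChar_iff.1 h
  refine ⟨h1.m_pos, lt_of_le_of_ne ?_ ?_⟩
  · by_contra! hlt
    exact (h2 1 le_rfl hg).2 ((symmetricMod_of_isBigO h1.isBigO _).mono hlt)
  · rintro h4
    exact h3 (h4 ▸ dvd_rfl)

variable [IsManifold 𝓘(ℂ, ℂ × ℂ) ω X] [IsManifold 𝓘(ℂ, ℂ × ℂ) ω Y]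

/-- A parametrization in a chart adapted to the affine charts of the blowing up. -/
theorem IsPuiseuxGerm.exists_blowupCharts {e₀ : OpenPartialHomeomorph X (ℂ × ℂ)}
    (h : IsPuiseuxGerm C P e₀ m f) (hB : IsBlowupAt π P) :
    ∃ e f₁ f₂ f', IsBlowupCharts π P e f₁ f₂ ∧ IsPuiseuxGerm C P e m f' ∧
      ∀ d, d ∣ m → ∀ b, SymmetricMod f d b ↔ SymmetricMod f' d b := by
  obtain ⟨e, f₁, f₂, hE⟩ := hB.exists_charts
  have he₀ := h.germ.centred
  have hφ := h.germ.change_chart hE.centred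
  -- Both coordinates cannot have order above `m`, since returning to `e₀` would give that order to
  -- `t ^ m`. A coordinate of order at most `m` is put first, by interchanging the affine charts if
  -- necessary.
  by_cases h1 : (fun t => (e (e₀.symm (t ^ m, f t))).1) =O[𝓝 0] fun t => t ^ (m + 1)
  · by_cases h2 : (fun t => (e (e₀.symm (t ^ m, f t))).2) =O[𝓝 0] fun t => t ^ (m + 1)
    · exfalso
      have h3 : (fun t => e₀ (e.symm (e (e₀.symm (t ^ m, f t))))) =O[𝓝 0]
          fun t => e (e₀.symm (t ^ m, f t)) := by
        have h4 := AnalyticAt.comp_sub_isBigO (hE.centred.transition he₀) hφ.tendsto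
          (tendsto_const_nhds (x := (0 : ℂ × ℂ)))
        simpa [hE.centred.symm_zero, he₀.centred] using h4
      have h5 : (fun t => (t ^ m, f t)) =O[𝓝 0] fun t => e (e₀.symm (t ^ m, f t)) := by
        refine h3.congr' ?_ EventuallyEq.rfl
        exact h.germ.tendsto.eventually (he₀.eventually_inverse hE.centred)
      have h6 : (fun t => e (e₀.symm (t ^ m, f t))) =O[𝓝 0] fun t : ℂ => t ^ (m + 1) :=
        h1.prod_left h2
      have := le_of_pow_isBigO_pow ((isBigO_fst_prod.trans h5).trans h6)
      omega
    · have h3 := AnalyticAt.pow_isBigO_of_not_isBigO (analyticAt_snd.comp hφ.analyticAt) h2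
      obtain ⟨f', h4, h5⟩ := h.change_chart hE.swap.centred h3
      exact ⟨_, _, _, f', hE.swap, h4, h5⟩
  · have h3 := AnalyticAt.pow_isBigO_of_not_isBigO (analyticAt_fst.comp hφ.analyticAt) h1
    obtain ⟨f', h4, h5⟩ := h.change_chart hE.centred h3
    exact ⟨_, _, _, f', hE, h4, h5⟩

theorem IsPuiseuxGerm.exists_strictTransform {e₀ : OpenPartialHomeomorph X (ℂ × ℂ)}
    (h : IsPuiseuxGerm C P e₀ m f) (hB : IsBlowupAt π P) (hC : IsClosed C) {Q : Y} (hQ : π Q = P)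
    (hQC : Q ∈ strictTransform π P C) :
    ∃ e k, IsParamGerm (strictTransform π P C) Q e (fun t => (t ^ m, k t)) ∧
      (k =O[𝓝 0] fun t => t ^ 1) ∧
      ∀ d, d ∣ m → ∀ b, IsCharExp f d (m + b) ↔ IsCharExp k d b := by
  obtain ⟨e, f₁, f₂, f', hE, h1, h2⟩ := h.exists_blowupCharts hB
  obtain ⟨k, hk, hfk⟩ := (AnalyticAt.isBigO_pow_iff_exists h1.analyticAt m).1 h1.isBigO
  obtain ⟨e', h3⟩ := hE.isParamGerm_strictTransform hB.holomorphic.continuous hC h1 hfk hk hQ hQC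
  refine ⟨e', _, h3, ?_, fun d hd b => ?_⟩
  · simpa using hk.differentiableAt.isBigO_sub
  · rw [IsCharExp, IsCharExp, symmetricMod_sub_const, symmetricMod_sub_const, h2 d hd, h2 d hd,
      add_assoc, symmetricMod_pow_mul hfk hd, symmetricMod_pow_mul hfk hd]

/-- Interchanging the coordinates of a germ `t ↦ (t ^ m, k t)` with `k` of order `n`. -/
theorem IsParamGerm.exists_inversion {e : OpenPartialHomeomorph X (ℂ × ℂ)} {n : ℕ} {k : ℂ → ℂ}
    (h : IsParamGerm C P e fun t => (t ^ m, k t)) (hn : 0 < n) (hnm : n ≤ m)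
    (h1 : k =O[𝓝 0] fun t => t ^ n) (h2 : (fun t => t ^ n) =O[𝓝 0] k) :
    ∃ e' F, IsPuiseuxGerm C P e' n F ∧ (F =O[𝓝 0] fun t => t ^ m) ∧
      (¬ F =O[𝓝 0] fun t => t ^ (m + 1)) ∧
      ∀ d, d ∣ m → d ∣ n → ∀ b, IsCharExp k d (n + b) → IsCharExp F d (m + b) := by
  have hm : 0 < m := hn.trans_le hnm
  have he := h.centred
  have h3 : IsParamGerm C P (swapChart e) fun t => (k t, t ^ m) := by
    refine (h.change_chart he.swap).congr ?_
    filter_upwards [h.tendsto.eventually (e.open_target.mem_nhds he.zero_mem_target)] with t ht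
    show (e (e.symm (t ^ m, k t))).swap = _
    rw [e.right_inv ht]
    rfl
  obtain ⟨T, S, hT, hT0, hTd, hS, hS0, hSd, hST, hTS, hTn, hSO, h4⟩ :=
    h3.normalize hn (h1.prod_left (pow_isBigO_pow hnm)) h2
  have hSt : Tendsto S (𝓝 0) (𝓝 0) := by simpa [hS0] using hS.continuousAt.tendsto
  have hTt : Tendsto T (𝓝 0) (𝓝 0) := by simpa [hT0] using hT.continuousAt.tendsto
  have hTO : T =O[𝓝 0] fun t => t := by
    simpa [hT0] using hT.differentiableAt.isBigO_sub
  have hFT : ∀ᶠ t in 𝓝 0, (fun s => S s ^ m) (T t) = t ^ m := by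
    filter_upwards [hST] with t ht
    simp only [ht]
  have hk : AnalyticAt ℂ k 0 := analyticAt_snd.comp h.analyticAt
  refine ⟨_, fun s => S s ^ m, h4, hSO.pow m, fun h5 => ?_, fun d hdm hdn b hb => ⟨?_, fun hs => ?_⟩⟩
  · have h6 := ((h5.comp_tendsto hTt).congr' hFT EventuallyEq.rfl).trans (hTO.pow (m + 1))
    have := le_of_pow_isBigO_pow h6
    omega
  · exact hb.1.inversion hT hT0 hTd hm hn hTn (hS.pow m) (hSO.pow m) hFT hdm hdn
  -- The same lemma for the inverse reparametrization `S`, with `m` and `n` exchanged, returns an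
  -- excess symmetry of `F` to `k`.
  · refine hb.2 (SymmetricMod.inversion (k := b + 1) hS hS0 hSd hn hm (by simp) hk h1 ?_ hdn hdm hs)
    filter_upwards [hSt.eventually hTn, hTS] with s h5 h6
    rw [← h5, h6]

/-- The effect of one blowing up on the Puiseux characteristic. -/
theorem HasPuiseuxChar.blowup {g : ℕ} {β : ℕ → ℕ} (h : HasPuiseuxChar C P m g β) (hg : 1 ≤ g)
    (hB : IsBlowupAt π P) (hC : IsClosed C) {Q : Y} (hQ : π Q = P)
    (hQC : Q ∈ strictTransform π P C) :
    (2 * m < β 1 ∧ HasPuiseuxChar (strictTransform π P C) Q m g fun i => β i - m) ∨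
    ∃ n, 0 < n ∧ n < m ∧ β 1 = m + n ∧
      ((¬ n ∣ m ∧ HasPuiseuxChar (strictTransform π P C) Q n g
          fun i => if i = 1 then m else β i - β 1 + m) ∨
        (n ∣ m ∧ HasPuiseuxChar (strictTransform π P C) Q n (g - 1)
          fun i => β (i + 1) - β 1 + m)) := by
  obtain ⟨hm, hlt⟩ := h.lt hg
  have hle : ∀ j, 1 ≤ j → j ≤ g → β 1 ≤ β j := fun j h1 h2 => h.le le_rfl h1 h2
  have hnd : ¬ m ∣ β 1 := h.not_dvd le_rfl hg
  obtain ⟨e, f, h1, h2, h3⟩ := hasPuiseuxChar_iff.1 h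
  obtain ⟨e', k, h4, h5, h6⟩ := h1.exists_strictTransform hB hC hQ hQC
  have hk : AnalyticAt ℂ k 0 := analyticAt_snd.comp h4.analyticAt
  obtain ⟨n, hn⟩ := Nat.exists_eq_add_of_lt hlt
  replace hn : β 1 = m + (n + 1) := by omega
  generalize n + 1 = n' at hn
  have h7 : ∀ j, 1 ≤ j → j ≤ g → IsCharExp k (gcdSeq m β j) (n' + (β j - β 1)) := by
    intro j h8 h9
    rw [← h6 _ (gcdSeq_dvd m β j)]
    have := hle j h8 h9
    have h10 : m + (n' + (β j - β 1)) = β j := by omega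
    rw [h10]
    exact h2 j h8 h9
  have hk1 : IsCharExp k m n' := by simpa [gcdSeq] using h7 1 le_rfl hg
  -- Here `n' = β 1 - m`; equality with `m` would make `m` divide β_1.
  rcases lt_trichotomy n' m with hnm | rfl | hnm
  · right
    have hn0 : 0 < n' := by omega
    have h8 : k =O[𝓝 0] fun t => t ^ n' := hk1.1.isBigO_pow hk h5 hm.ne' hnm.le le_rfl
    have h9 : (fun t => t ^ n') =O[𝓝 0] k :=
      AnalyticAt.pow_isBigO_of_not_isBigO hk fun h => hk1.2 (symmetricMod_of_isBigO h m)
    obtain ⟨e'', F, h10, h11, h12, h13⟩ := h4.exists_inversion hn0 hnm.le h8 h9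
    have h14 : ∀ j, 2 ≤ j → j ≤ g → IsCharExp F (gcdSeq m β j) (β j - β 1 + m) := by
      intro j hj hjg
      have h15 : gcdSeq m β j ∣ β 1 :=
        (gcdSeq_dvd_of_le m β (i := 2) (by omega) hj).trans (Nat.gcd_dvd_right _ _)
      rw [hn, Nat.dvd_add_right (gcdSeq_dvd m β j)] at h15
      rw [add_comm]
      exact h13 _ (gcdSeq_dvd m β j) h15 _ (h7 j (by omega) hjg)
    refine ⟨n', hn0, hnm, hn, ?_⟩
    by_cases hdvd : n' ∣ m
    · refine Or.inr ⟨hdvd, hasPuiseuxChar_iff.2 ⟨e'', F, h10, fun j hj hjg => ?_, ?_⟩⟩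
      · rw [gcdSeq_drop hn hdvd hle hj (by omega)]
        exact h14 (j + 1) (by omega) (by omega)
      · rw [gcdSeq_drop hn hdvd hle (by omega) (by omega), Nat.sub_add_cancel hg, h3]
    · refine Or.inl ⟨hdvd, hasPuiseuxChar_iff.2 ⟨e'', F, h10, fun j hj hjg => ?_, ?_⟩⟩
      · rcases hj.eq_or_lt with rfl | hj
        · exact isCharExp_of_exact_order h10.analyticAt hn0.ne' hdvd h11 h12
        · rw [gcdSeq_swap hn hle hj (by omega), if_neg (by omega)]
          exact h14 j hj hjg
      · rw [gcdSeq_swap hn hle (by omega) le_rfl, h3]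
  · exact absurd (hn ▸ dvd_add dvd_rfl dvd_rfl) hnd
  · left
    have hge : ∀ j, 1 ≤ j → j ≤ g → m ≤ β j := fun j h8 h9 => hlt.le.trans (hle j h8 h9)
    refine ⟨by omega, hasPuiseuxChar_iff.2 ⟨e', k, ⟨h4, hm, ?_⟩, fun j hj hjg => ?_, ?_⟩⟩
    · exact hk1.1.isBigO_pow hk h5 hm.ne' le_rfl hnm.le
    · rw [gcdSeq_sub hge hj (by omega)]
      have := hle j hj hjg
      have h8 : β j - m = n' + (β j - β 1) := by omega
      rw [h8]
      exact h7 j hj hjg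
    · rw [gcdSeq_sub hge (by omega) le_rfl, h3]

end BlowupStep

/-! ### Iterating blowings up until an exponent disappears. -/

section Sequence

variable {N : ℕ} {X : ℕ → Type*}
    [∀ n, TopologicalSpace (X n)] [∀ n, ChartedSpace (ℂ × ℂ) (X n)]
    [∀ n, IsManifold 𝓘(ℂ, ℂ × ℂ) ω (X n)]
    {π : ∀ n, X (n + 1) → X n} {C : ∀ n, Set (X n)} {P : ∀ n, X n}

/-- Blowing up until the number of characteristic exponents drops. -/
theorem exists_length_drop (hclosed : ∀ n ≤ N, IsClosed (C n))
    (hblowup : ∀ n < N, IsBlowupAt (π n) (P n))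
    (hstrict : ∀ n < N, C (n + 1) = strictTransform (π n) (P n) (C n))
    (hpoint : ∀ n < N, P (n + 1) ∈ C (n + 1) ∧ π n (P (n + 1)) = P n)
    (hsmooth : IsSmoothAt (C N) (P N)) {n : ℕ} (hn : n ≤ N) {m g : ℕ} {β : ℕ → ℕ} (hg : 1 ≤ g)
    (h : HasPuiseuxChar (C n) (P n) m g β) :
    ∃ n₁ ≤ N, HasPuiseuxChar (C n₁) (P n₁) (Nat.gcd m (β 1)) (g - 1)
        (fun i => β (i + 1) - β 1 + lastQuotient (β 1) m * Nat.gcd m (β 1)) ∧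
      ∀ n', n ≤ n' → n' < n₁ → ∃ m' β', HasPuiseuxChar (C n') (P n') m' g β' := by
  induction hn using Nat.decreasingInduction generalizing m β with
  | self =>
    have := h.length_unique (hsmooth.hasPuiseuxChar β)
    omega
  | of_succ n hn ih =>
    have hnd : ¬ m ∣ β 1 := h.not_dvd le_rfl hg
    have hrange : ∀ {n₁ : ℕ}, (∀ n', n + 1 ≤ n' → n' < n₁ → ∃ m' β',
        HasPuiseuxChar (C n') (P n') m' g β') → ∀ n', n ≤ n' → n' < n₁ → ∃ m' β',
        HasPuiseuxChar (C n') (P n') m' g β' := by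
      intro n₁ h1 n' h2 h3
      rcases h2.eq_or_lt with rfl | h2
      · exact ⟨m, β, h⟩
      · exact h1 n' h2 h3
    have hQC : P (n + 1) ∈ strictTransform (π n) (P n) (C n) := hstrict n hn ▸ (hpoint n hn).1
    have hcases := h.blowup hg (hblowup n hn) (hclosed n hn.le) (hpoint n hn).2 hQC
    rw [← hstrict n hn] at hcases
    rcases hcases with ⟨hlt, h1⟩ | ⟨r, hr, hrm, hr1, ⟨hd, h1⟩ | ⟨hd, h1⟩⟩
    · obtain ⟨n₁, h2, h3, h4⟩ := ih h1
      refine ⟨n₁, h2, ?_, hrange h4⟩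
      have hmod : β 1 - m ≡ β 1 [MOD m] := sub_modEq dvd_rfl (by omega)
      rw [gcd_congr_right hmod, ← lastQuotient_congr hmod.symm hnd] at h3
      convert h3 using 3
      omega
    · obtain ⟨n₁, h2, h3, h4⟩ := ih h1
      refine ⟨n₁, h2, ?_, hrange h4⟩
      have hgcd : Nat.gcd r m = Nat.gcd m (β 1) := by
        rw [hr1, Nat.gcd_comm]
        simp
      simp only [if_true] at h3
      rw [hgcd, ← lastQuotient_add_of_lt hr hrm, ← hr1] at h3
      convert h3 using 3 with i
      split_ifs with hi
      -- Index 0 is outside the characteristic, but equality of functions requires it; both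
      -- differences are 0 there.
      · obtain rfl : i = 0 := by omega
        simp
      · omega
    · refine ⟨n + 1, hn, ?_, hrange fun n' h2 h3 => absurd h3 (by omega)⟩
      have hgcd : Nat.gcd m (β 1) = r := by
        rw [hr1]
        simp [Nat.gcd_eq_right hd]
      -- Euclid's algorithm ends here: the last quotient times the gcd `r` is the current
      -- multiplicity `m`.
      rw [hgcd, hr1, lastQuotient_add_of_lt hr hrm, lastQuotient_of_dvd hr hd, ← hr1]
      exact h1

/-- Both β_{j-1} and the correction term are multiples of m_j. Hence the next gcd and last quotient
may be computed from the original β_j. -/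
theorem transformedExponent_modEq {m : ℕ} {β : ℕ → ℕ} {j : ℕ} (hj : 1 ≤ j)
    (hβ : 2 ≤ j → β (j - 1) ≤ β j) :
    transformedExponent m β j j ≡ β j [MOD gcdSeq m β j] := by
  rw [transformedExponent]
  split_ifs with h1
  · rfl
  · obtain ⟨i, rfl⟩ := Nat.exists_eq_add_of_le' hj
    have h2 := hβ (by omega)
    simp only [Nat.add_sub_cancel] at h2 ⊢
    refine (add_modEq (dvd_mul_left _ _)).trans (sub_modEq ?_ h2)
    rw [gcdSeq_succ m β (by omega)]
    exact Nat.gcd_dvd_right _ _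

end Sequence

end SurfaceCurve

/-! ### The main theorem, by induction on j. -/

theorem corollaryc (N : ℕ) (X : ℕ → Type*)
    [∀ n, TopologicalSpace (X n)] [∀ n, T2Space (X n)] [∀ n, ChartedSpace (ℂ × ℂ) (X n)]
    [∀ n, IsManifold 𝓘(ℂ, ℂ × ℂ) ω (X n)]
    (π : ∀ n, X (n + 1) → X n) (C : ∀ n, Set (X n)) (P : ∀ n, X n)
    (m g : ℕ) (β : ℕ → ℕ)
    (hcurve : SurfaceCurve.IsCurve (C 0))
    (hunibranch : SurfaceCurve.IsUnibranchAt (C 0) (P 0))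
    (hchar : SurfaceCurve.HasPuiseuxChar (C 0) (P 0) m g β)
    (hblowup : ∀ n < N, SurfaceCurve.IsBlowupAt (π n) (P n))
    (hstrict : ∀ n < N, C (n + 1) = SurfaceCurve.strictTransform (π n) (P n) (C n))
    (hpoint : ∀ n < N, P (n + 1) ∈ C (n + 1) ∧ π n (P (n + 1)) = P n)
    (hsmooth : SurfaceCurve.IsSmoothAt (C N) (P N)) :
    ∀ j, 1 ≤ j → j ≤ g →
      ∃ n ≤ N,
        SurfaceCurve.HasPuiseuxChar (C n) (P n) (SurfaceCurve.gcdSeq m β j) (g - j + 1)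
          (fun i => SurfaceCurve.transformedExponent m β j (j - 1 + i)) ∧
        ∀ n' < n, ∀ (m' g' : ℕ) (β' : ℕ → ℕ),
          SurfaceCurve.HasPuiseuxChar (C n') (P n') m' g' β' → g' ≠ g - j + 1 := by
  have hclosed : ∀ n ≤ N, IsClosed (C n) := by
    rintro (_ | n) hn
    · exact hcurve.1
    · rw [hstrict n hn]
      exact isClosed_closure
  -- For the induction, every earlier member is shown to have some characteristic with more
  -- exponents; uniqueness of the length then excludes all others.
  suffices H : ∀ j, 1 ≤ j → j ≤ g → ∃ n ≤ N,
      SurfaceCurve.HasPuiseuxChar (C n) (P n) (SurfaceCurve.gcdSeq m β j) (g - j + 1)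
        (fun i => SurfaceCurve.transformedExponent m β j (j - 1 + i)) ∧
      ∀ n' < n, ∃ m' g' β', SurfaceCurve.HasPuiseuxChar (C n') (P n') m' g' β' ∧
        g - j + 1 < g' by
    intro j hj hjg
    obtain ⟨n, hn, h1, h2⟩ := H j hj hjg
    refine ⟨n, hn, h1, fun n' hn' m' g' β' h3 => ?_⟩
    obtain ⟨m'', g'', β'', h4, h5⟩ := h2 n' hn'
    rw [h3.length_unique h4]
    exact h5.ne'
  intro j hj
  induction j, hj using Nat.le_induction with
  | base =>
    intro hg
    refine ⟨0, N.zero_le, ?_, fun n' hn' => absurd hn' n'.not_lt_zero⟩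
    rw [Nat.sub_add_cancel hg]
    simpa [SurfaceCurve.transformedExponent, SurfaceCurve.gcdSeq] using hchar
  | succ j hj ih =>
    intro hjg
    obtain ⟨n, hn, h1, h2⟩ := ih (by omega)
    obtain ⟨n₁, hn₁, h3, h4⟩ := SurfaceCurve.exists_length_drop hclosed hblowup hstrict hpoint
      hsmooth hn (by omega) h1
    have hle : 2 ≤ j → β (j - 1) ≤ β j := fun h5 => hchar.le (by omega) (by omega) (by omega)
    have hmod := SurfaceCurve.transformedExponent_modEq (m := m) hj hle
    have hnd := hchar.not_dvd hj (by omega)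
    have hj1 : j - 1 + 1 = j := Nat.sub_add_cancel hj
    simp only [hj1] at h3
    rw [SurfaceCurve.gcd_congr_right hmod, ← SurfaceCurve.gcdSeq_succ m β hj,
      ← SurfaceCurve.lastQuotient_congr hmod.symm hnd] at h3
    refine ⟨n₁, hn₁, ?_, fun n' hn' => ?_⟩
    · have hlen : g - (j + 1) + 1 = g - j + 1 - 1 := by omega
      rw [hlen]
      convert h3 using 2 with i
      have hidx : j - 1 + (i + 1) = j + i := by omega
      rw [hidx, SurfaceCurve.transformedExponent, SurfaceCurve.transformedExponent,
        SurfaceCurve.transformedExponent, if_neg (by omega)]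
      simp only [Nat.add_sub_cancel]
      -- The differences telescope: the previous corrections cancel, and β_{j-1} ≤ β_j keeps this
      -- valid for truncated subtraction.
      split_ifs with h5
      · rfl
      · have := hle (by omega)
        omega
    · rcases lt_or_ge n' n with h5 | h5
      · obtain ⟨m', g', β', h6, h7⟩ := h2 n' h5
        exact ⟨m', g', β', h6, by omega⟩
      · obtain ⟨m', β', h6⟩ := h4 n' h5 hn'
        exact ⟨m', _, β', h6, by omega⟩
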